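/- Let $M$ be a smooth surface with finitely many ends (at least one): outside a compact set $M$ is the disjoint union of ends $E_1,\dots,E_\ell$, each carrying smooth coordinates $(r,\theta)$, $r$ large, $\theta\in\mathbb R/2\pi\mathbb Z$. Let $g_0$ be a Riemannian metric on $M$ which is asymptotically conical of some order $\tau>0$: for some $\beta\in(0,1)$ and on each end $E_j$, for some $\alpha_j>0$, $g_0=dr^2+\alpha_j^2r^2d\theta^2+k_j$ for $r$ large, where $k_j\in r^{-\tau}\Lambda^{2,\beta}$, i.e. $r^\tau k_j$ is bounded in the Hölder space $C^{2,\beta}$ of the model cone (its components in the frame $\partial_r$, $r^{-1}\partial_\theta$, and their first and second derivatives along this frame, are bounded, and the second derivatives are uniformly Hölder continuous with exponent $\beta$ for the cone distance). Let $g(t)$, $0\le t<\infty$, be a solution of the Ricci flow $$\partial_t g=-2\,\mathrm{Ric}(g(t)),\qquad g(0)=g_0,$$ on $M$ (with components smooth in space and time for $t>0$ and, together with their space derivatives of order at most two, continuous up to $t=0$), with curvature bounded on $M\times[0,T]$ for every finite $T$. Let $R(x,t)$ be the scalar curvature of $g(t)$ at $x$. If $R(x,0)\le 0$ for all $x\in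 M$, then $R(x,t)\le 0$ for all $x\in M$ and all $t\ge 0$. -/

import Mathlib

open scoped Manifold ContDiff Topology

noncomputable section

namespace ACSurface

/-- The coordinate plane. -/
abbrev Plane : Type := EuclideanSpace ℝ (Fin 2)

/-! ### Curvature of a metric given by its component functions on the plane -/

/-- The partial derivative `∂ᵢ f`. -/
def pd (i : Fin 2) (f : Plane → ℝ) (y : Plane) : ℝ :=
  fderiv ℝ f y (EuclideanSpace.single i 1)

/-- The Christoffel symbol `Γᵏᵢⱼ` of the metric with components `G`. -/
def christoffel (G : Plane → Matrix (Fin 2) (Fin 2) ℝ) (k i j : Fin 2) (y : Plane) : ℝ :=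
  (1 / 2) * ∑ l, (G y)⁻¹ k l *
    (pd i (fun z => G z j l) y + pd j (fun z => G z i l) y - pd l (fun z => G z i j) y)

/-- The component `Ricᵢⱼ` of the Ricci tensor of the metric with components `G`. -/
def ricci (G : Plane → Matrix (Fin 2) (Fin 2) ℝ) (i j : Fin 2) (y : Plane) : ℝ :=
  (∑ k, (pd k (christoffel G k i j) y - pd j (christoffel G k i k) y)) +
    ∑ k, ∑ l, (christoffel G k k l y * christoffel G l i j y -
      christoffel G k j l y * christoffel G l i k y)

/-- The scalar curvature (twice the Gauss curvature) of the metric with components `G`. -/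
def scalar (G : Plane → Matrix (Fin 2) (Fin 2) ℝ) (y : Plane) : ℝ :=
  ∑ i, ∑ j, (G y)⁻¹ i j * ricci G i j y

section Surface

variable {M : Type*} [TopologicalSpace M] [ChartedSpace Plane M] [IsManifold (𝓡 2) ∞ M]

variable (M) in
/-- Riemannian metrics of class `C²` on the surface `M`. -/
abbrev Metric : Type _ :=
  Bundle.ContMDiffRiemannianMetric (𝓡 2) 2 Plane (fun x : M => TangentSpace (𝓡 2) x)

/-- The components of the pull-back of `g` under a map `Φ` from the plane to `M`:
`gᵢⱼ(y) = g (∂ᵢΦ(y), ∂ⱼΦ(y))`. With `Φ = e.symm` these are the components of `g` in the chart `e`. -/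
def comp (g : Metric M) (Φ : Plane → M) (y : Plane) : Matrix (Fin 2) (Fin 2) ℝ :=
  Matrix.of fun i j => g.inner (Φ y)
    (mfderiv (𝓡 2) (𝓡 2) Φ y (EuclideanSpace.single i (1 : ℝ) : Plane))
    (mfderiv (𝓡 2) (𝓡 2) Φ y (EuclideanSpace.single j (1 : ℝ) : Plane))

/-- The scalar curvature of `g` at the point `x`, computed in a chart around `x`. -/
def scalarCurvature (g : Metric M) (x : M) : ℝ :=
  scalar (comp g (chartAt Plane x).symm) (chartAt Plane x x)

/-- `g t`, `0 ≤ t < ∞`, is a classical solution of the Ricci flow `∂ₜ g = -2 Ric (g t)`: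
in every chart of the smooth structure the components are smooth in `(t, y)` for `t > 0`, they and
their space derivatives up to order two are continuous up to `t = 0`, and the equation holds for
`t > 0`. The values of `g` at negative times play no role. -/
structure IsRicciFlow (g : ℝ → Metric M) : Prop where
  smooth : ∀ e ∈ IsManifold.maximalAtlas (𝓡 2) ∞ M, ∀ i j : Fin 2,
    ContDiffOn ℝ ∞ (fun p : ℝ × Plane => comp (g p.1) e.symm p.2 i j)
      (Set.Ioi 0 ×ˢ e.target)
  continuous_zero : ∀ e ∈ IsManifold.maximalAtlas (𝓡 2) ∞ M, ∀ i j : Fin 2,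
    ContinuousOn (fun p : ℝ × Plane => comp (g p.1) e.symm p.2 i j)
      (Set.Ici 0 ×ˢ e.target)
  continuous_one : ∀ e ∈ IsManifold.maximalAtlas (𝓡 2) ∞ M, ∀ i j k : Fin 2,
    ContinuousOn (fun p : ℝ × Plane => pd k (fun z => comp (g p.1) e.symm z i j) p.2)
      (Set.Ici 0 ×ˢ e.target)
  continuous_two : ∀ e ∈ IsManifold.maximalAtlas (𝓡 2) ∞ M, ∀ i j k l : Fin 2,
    ContinuousOn (fun p : ℝ × Plane => pd l (pd k (fun z => comp (g p.1) e.symm z i j)) p.2)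
      (Set.Ici 0 ×ˢ e.target)
  equation : ∀ e ∈ IsManifold.maximalAtlas (𝓡 2) ∞ M, ∀ i j : Fin 2, ∀ t : ℝ, 0 < t →
    ∀ y ∈ e.target,
      HasDerivAt (fun s => comp (g s) e.symm y i j) (-2 * ricci (comp (g t) e.symm) i j y) t

/-- The curvature of the family `g t` is bounded on every finite time interval `[0, T]`. -/
def HasBoundedCurvature (g : ℝ → Metric M) : Prop :=
  ∀ T : ℝ, ∃ C : ℝ, ∀ t ∈ Set.Icc 0 T, ∀ x : M, |scalarCurvature (g t) x| ≤ C

/-! ### Asymptotically conical metrics -/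

variable (M) in
/-- A presentation of `M` as a surface with finitely many cylindrical ends (at least one).
The `a`-th end carries coordinates `(r, θ)`, with `r > innerRadius a` and `θ` modulo `2π`;
`polar a` sends a pair `(r, θ)` of real numbers to the point with these coordinates. -/
structure Ends where
  num : ℕ
  num_pos : 0 < num
  innerRadius : Fin num → ℝ
  innerRadius_pos : ∀ a, 0 < innerRadius a
  polar : Fin num → Plane → M
  localDiffeo : ∀ a, IsLocalDiffeomorphOn (𝓡 2) (𝓡 2) ∞ (polar a) {y | innerRadius a < y 0}
  polar_eq_iff : ∀ a, ∀ y z : Plane, innerRadius a < y 0 → innerRadius a < z 0 →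
    (polar a y = polar a z ↔ y 0 = z 0 ∧ ∃ m : ℤ, y 1 = z 1 + m * (2 * Real.pi))
  disjoint : ∀ a b, a ≠ b → Disjoint (polar a '' {y | innerRadius a < y 0})
    (polar b '' {y | innerRadius b < y 0})
  isClosed_image : ∀ a, ∀ ρ : ℝ, innerRadius a < ρ → IsClosed (polar a '' {y | ρ ≤ y 0})
  isCompact_core : ∀ ρ : Fin num → ℝ, (∀ a, innerRadius a < ρ a) →
    IsCompact (⋃ a, polar a '' {y | ρ a < y 0})ᶜ

/-- The frame `∂_r`, `r⁻¹ ∂_θ` on a cone, acting on functions of `(r, θ)`. -/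
def coneDeriv (i : Fin 2) (f : Plane → ℝ) (y : Plane) : ℝ :=
  if i = 0 then pd 0 f y else (y 0)⁻¹ * pd 1 f y

/-- The function `f` of `(r, θ)` is of class `Λ^{2,β}` on the region `r ≥ ρ` of a cone: `f`, its
first and its second derivatives (with respect to `∂_r` and `r⁻¹ ∂_θ`) are bounded, and the second
derivatives are Hölder continuous with exponent `β` for the distance of the cone. -/
def MemHolder (β ρ : ℝ) (f : Plane → ℝ) : Prop :=
  (∀ y : Plane, ρ ≤ y 0 → ContDiffAt ℝ 2 f y) ∧
  ∃ C : ℝ,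
    (∀ y : Plane, ρ ≤ y 0 → |f y| ≤ C ∧ (∀ i, |coneDeriv i f y| ≤ C) ∧
      ∀ i j, |coneDeriv i (coneDeriv j f) y| ≤ C) ∧
    ∀ i j, ∀ y z : Plane, ρ ≤ y 0 → ρ ≤ z 0 →
      |coneDeriv i (coneDeriv j f) y - coneDeriv i (coneDeriv j f) z| ≤
        C * (|y 0 - z 0| + min (y 0) (z 0) * |y 1 - z 1|) ^ β

/-- The components, in the frame `∂_r`, `r⁻¹ ∂_θ`, of `k = G - (dr² + α² r² dθ²)`, where `G` is
given by its components in the coordinates `(r, θ)`. -/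
def coneError (α : ℝ) (G : Plane → Matrix (Fin 2) (Fin 2) ℝ) (i j : Fin 2) (y : Plane) : ℝ :=
  let w : Fin 2 → ℝ := ![1, y 0]
  (G y i j - (!![1, 0; 0, α ^ 2 * (y 0) ^ 2] : Matrix (Fin 2) (Fin 2) ℝ) i j) / (w i * w j)

/-- `g` is asymptotically conical of order `τ`: `M` has finitely many ends, with coordinates
`(r, θ)`, and on each of them `g` differs from a model cone metric `dr² + α² r² dθ²`, `α > 0`,
by an error term in `r^{-τ} Λ^{2,β}`. -/
def IsAsymptoticallyConical (τ : ℝ) (g : Metric M) : Prop :=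
  0 < τ ∧ ∃ β : ℝ, 0 < β ∧ β < 1 ∧ ∃ E : Ends M, ∀ a : Fin E.num,
    ∃ α ρ : ℝ, 0 < α ∧ E.innerRadius a < ρ ∧ ∀ i j : Fin 2,
      MemHolder β ρ (fun y => (y 0) ^ τ * coneError α (comp g (E.polar a)) i j y)

end Surface

end ACSurface

end

open scoped Manifold ContDiff Topology

noncomputable section

namespace ACSurface

/-! ### Partial derivatives -/

/-! In dimension two Ric = K g with K = R/2 the Gauss curvature, so the flow reads ∂ₜg = -R g. It
moves g within its conformal class, and the conformal change formula for K gives ∂ₜR = ΔR + R². On a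
compact surface the maximum principle would finish the proof: where 0 < R < A, the quantity e^{-At}R
has reaction term e^{-At}R(R - A) < 0, so it cannot have a positive maximum at a positive time.

Noncompactness is handled by a barrier: a proper function φ ≥ 0 with Δφ ≤ B for the initial metric.
With R ≤ A on [0,T], conformality gives g(0) ≤ e^{AT} g(t), and the conformal covariance of the
Laplacian in dimension two turns the bound into Δφ ≤ B' = e^{AT}B at every time in [0,T]. If R were
positive somewhere at time T, then for small ε > 0 the function e^{-As}R - ε(φ + B's + 1) would have
a positive maximum over [0,T] × M, since R is bounded and φ is proper. The maximum lies at a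
positive time because R ≤ 0 initially, and there the evolution equation is contradicted
(`IsRicciFlow.not_isMax`).

The barrier is a smoothed radius on each end, extended by zero (`exists_isBarrier`). On an
asymptotic cone the inverse metric is bounded, and so are its first derivatives in the frame ∂_r,
r⁻¹∂_θ, whence Δr is bounded. -/

lemma pd_congr {f g : Plane → ℝ} {y : Plane} (h : f =ᶠ[𝓝 y] g) (i : Fin 2) :
    pd i f y = pd i g y := by
  simp only [pd, h.fderiv_eq]

lemma pd_eventuallyEq {f g : Plane → ℝ} {y : Plane} (h : f =ᶠ[𝓝 y] g) (i : Fin 2) :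
    pd i f =ᶠ[𝓝 y] pd i g :=
  h.eventuallyEq_nhds.mono fun _ hz => pd_congr hz i

lemma pd_const (i : Fin 2) (c : ℝ) (y : Plane) : pd i (fun _ => c) y = 0 := by
  simp [pd]

lemma pd_add {f g : Plane → ℝ} {y : Plane} (hf : DifferentiableAt ℝ f y)
    (hg : DifferentiableAt ℝ g y) (i : Fin 2) :
    pd i (fun z => f z + g z) y = pd i f y + pd i g y := by
  simp only [pd]; rw [fderiv_fun_add hf hg]; rfl

lemma pd_sub {f g : Plane → ℝ} {y : Plane} (hf : DifferentiableAt ℝ f y)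
    (hg : DifferentiableAt ℝ g y) (i : Fin 2) :
    pd i (fun z => f z - g z) y = pd i f y - pd i g y := by
  simp only [pd]; rw [fderiv_fun_sub hf hg]; rfl

lemma pd_neg (f : Plane → ℝ) (y : Plane) (i : Fin 2) :
    pd i (fun z => - f z) y = - pd i f y := by
  simp only [pd]; rw [fderiv_fun_neg]; rfl

lemma pd_mul {f g : Plane → ℝ} {y : Plane} (hf : DifferentiableAt ℝ f y)
    (hg : DifferentiableAt ℝ g y) (i : Fin 2) :
    pd i (fun z => f z * g z) y = f y * pd i g y + pd i f y * g y := by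
  simp only [pd]; rw [fderiv_fun_mul hf hg]; simp [mul_comm]

lemma pd_const_mul {f : Plane → ℝ} {y : Plane} (hf : DifferentiableAt ℝ f y) (c : ℝ) (i : Fin 2) :
    pd i (fun z => c * f z) y = c * pd i f y := by
  rw [pd_mul (by fun_prop) hf, pd_const]; ring

lemma pd_comp {φ : ℝ → ℝ} {φ' : ℝ} {f : Plane → ℝ} {y : Plane} (hφ : HasDerivAt φ φ' (f y))
    (hf : DifferentiableAt ℝ f y) (i : Fin 2) :
    pd i (fun z => φ (f z)) y = φ' * pd i f y := by
  have := (hφ.comp_hasFDerivAt y hf.hasFDerivAt).fderiv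
  simp only [pd]
  change fderiv ℝ (φ ∘ f) y _ = _
  rw [this]; simp

lemma pd_div {f g : Plane → ℝ} {y : Plane} (hf : DifferentiableAt ℝ f y)
    (hg : DifferentiableAt ℝ g y) (h0 : g y ≠ 0) (i : Fin 2) :
    pd i (fun z => f z / g z) y = (pd i f y * g y - f y * pd i g y) / g y ^ 2 := by
  have h := pd_comp (hasDerivAt_inv h0) hg i
  simp only [div_eq_mul_inv]
  rw [pd_mul (g := fun z => (g z)⁻¹) hf (hg.fun_inv h0), h]
  field_simp
  ring

lemma contDiffAt_pd {n m : WithTop ℕ∞} {f : Plane → ℝ} {y : Plane} (hf : ContDiffAt ℝ n f y)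
    (hm : m + 1 ≤ n) (i : Fin 2) : ContDiffAt ℝ m (pd i f) y :=
  (hf.fderiv_right hm).clm_apply contDiffAt_const

lemma pd_comm {f : Plane → ℝ} {y : Plane} (hf : ContDiffAt ℝ 2 f y) (i j : Fin 2) :
    pd i (pd j f) y = pd j (pd i f) y := by
  have hd : DifferentiableAt ℝ (fderiv ℝ f) y :=
    (hf.fderiv_right (m := 1) (by norm_num)).differentiableAt (by norm_num)
  have hs := hf.isSymmSndFDerivAt (by simp)
  have key : ∀ a b : Fin 2, pd a (pd b f) y =
      fderiv ℝ (fderiv ℝ f) y (EuclideanSpace.single a 1) (EuclideanSpace.single b 1) := by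
    intro a b
    unfold pd
    rw [fderiv_clm_apply hd (by fun_prop)]
    simp
  rw [key, key, hs.eq]

/-! ### Curvature in dimension two -/

/-- `G` is near `y` the component matrix of a Riemannian metric of class `C²`. -/
structure IsMetricAt (G : Plane → Matrix (Fin 2) (Fin 2) ℝ) (y : Plane) : Prop where
  contDiffAt : ∀ i j, ContDiffAt ℝ 2 (fun z => G z i j) y
  symm : ∀ᶠ z in 𝓝 y, G z 1 0 = G z 0 1
  pos : 0 < G y 0 0
  det_pos : 0 < G y 0 0 * G y 1 1 - G y 0 1 ^ 2

/-- The Laplacian of `f` for the metric with components `G`. -/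
def laplacian (G : Plane → Matrix (Fin 2) (Fin 2) ℝ) (f : Plane → ℝ) (y : Plane) : ℝ :=
  ∑ i, ∑ j, (G y)⁻¹ i j * (pd i (pd j f) y - ∑ k, christoffel G k i j y * pd k f y)

/-- Brioschi's expression for the Gauss curvature in terms of the components of the metric and
their derivatives of order at most two. -/
def brioschi (E F D E₀ E₁ F₀ F₁ D₀ D₁ E₁₁ F₀₁ D₀₀ : ℝ) : ℝ :=
  ((-E₁₁ / 2 + F₀₁ - D₀₀ / 2) * (E * D - F ^ 2)
    - E₀ / 2 * ((F₁ - D₀ / 2) * D - F * (D₁ / 2))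
    + (F₀ - E₁ / 2) * ((F₁ - D₀ / 2) * F - E * (D₁ / 2))
    + E₁ / 2 * (E₁ / 2 * D - F * (D₀ / 2))
    - D₀ / 2 * (E₁ / 2 * F - E * (D₀ / 2))) / (E * D - F ^ 2) ^ 2

/-- The Gauss curvature of the metric with components `G`. -/
def gauss (G : Plane → Matrix (Fin 2) (Fin 2) ℝ) (y : Plane) : ℝ :=
  brioschi (G y 0 0) (G y 0 1) (G y 1 1) (pd 0 (fun z => G z 0 0) y) (pd 1 (fun z => G z 0 0) y)
    (pd 0 (fun z => G z 0 1) y) (pd 1 (fun z => G z 0 1) y) (pd 0 (fun z => G z 1 1) y)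
    (pd 1 (fun z => G z 1 1) y) (pd 1 (pd 1 (fun z => G z 0 0)) y)
    (pd 0 (pd 1 (fun z => G z 0 1)) y) (pd 0 (pd 0 (fun z => G z 1 1)) y)

lemma inv_fin_two (A : Matrix (Fin 2) (Fin 2) ℝ) (h : A 1 0 = A 0 1)
    (hd : A 0 0 * A 1 1 - A 0 1 ^ 2 ≠ 0) :
    A⁻¹ = !![A 1 1 / (A 0 0 * A 1 1 - A 0 1 ^ 2), -A 0 1 / (A 0 0 * A 1 1 - A 0 1 ^ 2);
      -A 0 1 / (A 0 0 * A 1 1 - A 0 1 ^ 2), A 0 0 / (A 0 0 * A 1 1 - A 0 1 ^ 2)] := by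
  apply Matrix.inv_eq_right_inv
  ext i j
  fin_cases i <;> fin_cases j <;>
    simp [Matrix.mul_apply, Fin.sum_univ_two, h] <;> field_simp <;> ring

namespace IsMetricAt

variable {G : Plane → Matrix (Fin 2) (Fin 2) ℝ} {y : Plane}

lemma eventually_det_pos (hG : IsMetricAt G y) :
    ∀ᶠ z in 𝓝 y, 0 < G z 0 0 * G z 1 1 - G z 0 1 ^ 2 := by
  have h00 := (hG.contDiffAt 0 0).continuousAt
  have h01 := (hG.contDiffAt 0 1).continuousAt
  have h11 := (hG.contDiffAt 1 1).continuousAt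
  exact ((h00.mul h11).sub (h01.pow 2)).eventually (lt_mem_nhds hG.det_pos)

lemma eventually (hG : IsMetricAt G y) : ∀ᶠ z in 𝓝 y, IsMetricAt G z := by
  have h00 := (hG.contDiffAt 0 0).continuousAt
  have hc : ∀ i j, ∀ᶠ z in 𝓝 y, ContDiffAt ℝ 2 (fun z => G z i j) z := fun i j =>
    (hG.contDiffAt i j).eventually (by simp)
  have hc' : ∀ᶠ z in 𝓝 y, ∀ i j, ContDiffAt ℝ 2 (fun z => G z i j) z := by
    simpa only [Filter.eventually_all] using hc
  filter_upwards [hc', hG.symm.eventually_nhds, h00.eventually (lt_mem_nhds hG.pos),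
    hG.eventually_det_pos] with z h1 h2 h3 h4
  exact ⟨h1, h2, h3, h4⟩

lemma christoffel_eq (hG : IsMetricAt G y) :
    (∀ k, christoffel G k 1 0 y = christoffel G k 0 1 y) ∧
    christoffel G 0 0 0 y = (G y 1 1 * pd 0 (fun z => G z 0 0) y - G y 0 1 *
      (2 * pd 0 (fun z => G z 0 1) y - pd 1 (fun z => G z 0 0) y)) /
        (2 * (G y 0 0 * G y 1 1 - G y 0 1 ^ 2)) ∧
    christoffel G 0 0 1 y = (G y 1 1 * pd 1 (fun z => G z 0 0) y - G y 0 1 *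
      pd 0 (fun z => G z 1 1) y) / (2 * (G y 0 0 * G y 1 1 - G y 0 1 ^ 2)) ∧
    christoffel G 0 1 1 y = (G y 1 1 * (2 * pd 1 (fun z => G z 0 1) y -
      pd 0 (fun z => G z 1 1) y) - G y 0 1 * pd 1 (fun z => G z 1 1) y) /
        (2 * (G y 0 0 * G y 1 1 - G y 0 1 ^ 2)) ∧
    christoffel G 1 0 0 y = (G y 0 0 * (2 * pd 0 (fun z => G z 0 1) y -
      pd 1 (fun z => G z 0 0) y) - G y 0 1 * pd 0 (fun z => G z 0 0) y) /
        (2 * (G y 0 0 * G y 1 1 - G y 0 1 ^ 2)) ∧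
    christoffel G 1 0 1 y = (G y 0 0 * pd 0 (fun z => G z 1 1) y - G y 0 1 *
      pd 1 (fun z => G z 0 0) y) / (2 * (G y 0 0 * G y 1 1 - G y 0 1 ^ 2)) ∧
    christoffel G 1 1 1 y = (G y 0 0 * pd 1 (fun z => G z 1 1) y - G y 0 1 *
      (2 * pd 1 (fun z => G z 0 1) y - pd 0 (fun z => G z 1 1) y)) /
        (2 * (G y 0 0 * G y 1 1 - G y 0 1 ^ 2)) := by
  have h1 := hG.symm.self_of_nhds
  have h2 := hG.det_pos.ne'
  have h3 : ∀ i, pd i (fun z => G z 1 0) y = pd i (fun z => G z 0 1) y :=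
    fun i => pd_congr hG.symm i
  refine ⟨fun k => ?_, ?_, ?_, ?_, ?_, ?_, ?_⟩
  · fin_cases k <;> simp only [christoffel, inv_fin_two _ h1 h2, Fin.sum_univ_two, h3] <;>
      ring
  all_goals
    simp only [christoffel, inv_fin_two _ h1 h2, Fin.sum_univ_two, h3]
    simp
    field_simp
    ring

/-- The Christoffel symbols in `christoffel_eq` all have this shape, with w the determinant of the
metric. -/
lemma pd_quotient {a b c d w : Plane → ℝ} (ha : DifferentiableAt ℝ a y)
    (hb : DifferentiableAt ℝ b y) (hc : DifferentiableAt ℝ c y) (hd : DifferentiableAt ℝ d y)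
    (hw : DifferentiableAt ℝ w y) (h0 : w y ≠ 0) (i : Fin 2) :
    pd i (fun z => (a z * b z - c z * d z) / (2 * w z)) y =
      ((a y * pd i b y + pd i a y * b y - (c y * pd i d y + pd i c y * d y)) * w y -
        (a y * b y - c y * d y) * pd i w y) / (2 * w y ^ 2) := by
  rw [pd_div ((ha.fun_mul hb).fun_sub (hc.fun_mul hd)) (hw.const_mul 2) (by positivity),
    pd_sub (ha.fun_mul hb) (hc.fun_mul hd), pd_mul ha hb, pd_mul hc hd, pd_const_mul hw]
  field_simp

/-- In dimension two the Ricci tensor is the Gauss curvature times the metric. -/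
lemma ricci_eq (hG : IsMetricAt G y) (i j : Fin 2) : ricci G i j y = gauss G y * G y i j := by
  have h1 := hG.symm.self_of_nhds
  have h2 := hG.det_pos.ne'
  have hc : ∀ i j, ContDiffAt ℝ 2 (fun z => G z i j) y := hG.contDiffAt
  have hd : ∀ i j, DifferentiableAt ℝ (fun z => G z i j) y := fun i j =>
    (hc i j).differentiableAt (by norm_num)
  have hdd : ∀ i j k, DifferentiableAt ℝ (pd k (fun z => G z i j)) y := fun i j k =>
    (contDiffAt_pd (m := 1) (hc i j) (by norm_num) k).differentiableAt (by norm_num)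
  have hw : DifferentiableAt ℝ (fun z => G z 0 0 * G z 1 1 - G z 0 1 ^ 2) y :=
    ((hd 0 0).fun_mul (hd 1 1)).fun_sub ((hd 0 1).fun_pow 2)
  have hpw : ∀ i, pd i (fun z => G z 0 0 * G z 1 1 - G z 0 1 ^ 2) y =
      G y 0 0 * pd i (fun z => G z 1 1) y + pd i (fun z => G z 0 0) y * G y 1 1 -
        2 * G y 0 1 * pd i (fun z => G z 0 1) y := by
    intro i
    simp only [pow_two]
    rw [pd_sub ((hd 0 0).fun_mul (hd 1 1)) ((hd 0 1).fun_mul (hd 0 1)), pd_mul (hd 0 0) (hd 1 1),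
      pd_mul (hd 0 1) (hd 0 1)]
    ring
  have hev := hG.eventually.mono fun z hz => hz.christoffel_eq
  have h10 : ∀ k i, pd i (christoffel G k 1 0) y = pd i (christoffel G k 0 1) y := fun k i =>
    pd_congr (hev.mono fun z hz => hz.1 k) i
  have e000 := pd_congr (hev.mono fun z hz => hz.2.1)
  have e001 := pd_congr (hev.mono fun z hz => hz.2.2.1)
  have e011 := pd_congr (hev.mono fun z hz => hz.2.2.2.1)
  have e100 := pd_congr (hev.mono fun z hz => hz.2.2.2.2.1)
  have e101 := pd_congr (hev.mono fun z hz => hz.2.2.2.2.2.1)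
  have e111 := pd_congr (hev.mono fun z hz => hz.2.2.2.2.2.2)
  obtain ⟨c10, c000, c001, c011, c100, c101, c111⟩ := hG.christoffel_eq
  have hs1 : ∀ i, pd i (fun z => 2 * pd 0 (fun z => G z 0 1) z - pd 1 (fun z => G z 0 0) z) y =
      2 * pd i (pd 0 (fun z => G z 0 1)) y - pd i (pd 1 (fun z => G z 0 0)) y := fun i => by
    rw [pd_sub ((hdd 0 1 0).const_mul 2) (hdd 0 0 1), pd_const_mul (hdd 0 1 0)]
  have hs2 : ∀ i, pd i (fun z => 2 * pd 1 (fun z => G z 0 1) z - pd 0 (fun z => G z 1 1) z) y =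
      2 * pd i (pd 1 (fun z => G z 0 1)) y - pd i (pd 0 (fun z => G z 1 1)) y := fun i => by
    rw [pd_sub ((hdd 0 1 1).const_mul 2) (hdd 1 1 0), pd_const_mul (hdd 0 1 1)]
  have hsd1 : DifferentiableAt ℝ
      (fun z => 2 * pd 0 (fun z => G z 0 1) z - pd 1 (fun z => G z 0 0) z) y :=
    ((hdd 0 1 0).const_mul 2).fun_sub (hdd 0 0 1)
  have hsd2 : DifferentiableAt ℝ
      (fun z => 2 * pd 1 (fun z => G z 0 1) z - pd 0 (fun z => G z 1 1) z) y :=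
    ((hdd 0 1 1).const_mul 2).fun_sub (hdd 1 1 0)
  simp only [pd_quotient (hd 1 1) (hdd 0 0 0) (hd 0 1) hsd1 hw h2, hs1, hpw] at e000
  simp only [pd_quotient (hd 1 1) (hdd 0 0 1) (hd 0 1) (hdd 1 1 0) hw h2, hpw] at e001
  simp only [pd_quotient (hd 1 1) hsd2 (hd 0 1) (hdd 1 1 1) hw h2, hs2, hpw] at e011
  simp only [pd_quotient (hd 0 0) hsd1 (hd 0 1) (hdd 0 0 0) hw h2, hs1, hpw] at e100
  simp only [pd_quotient (hd 0 0) (hdd 1 1 0) (hd 0 1) (hdd 0 0 1) hw h2, hpw] at e101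
  simp only [pd_quotient (hd 0 0) (hdd 1 1 1) (hd 0 1) hsd2 hw h2, hs2, hpw] at e111
  have hcomm : ∀ i j, pd 1 (pd 0 (fun z => G z i j)) y = pd 0 (pd 1 (fun z => G z i j)) y :=
    fun i j => pd_comm (hc i j) 1 0
  have h2' : G y 1 1 * G y 0 0 - G y 0 1 ^ 2 ≠ 0 := by rwa [mul_comm]
  revert i j
  simp only [Fin.forall_fin_two, ricci, gauss, brioschi, Fin.sum_univ_two]
  refine ⟨⟨?_, ?_⟩, ?_, ?_⟩
  -- Both sides are now rational functions of the 2-jet of the metric with powers of the determinant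
  -- as denominators, and mixed derivatives are in one fixed order.
  all_goals
    simp only [h10, h1, c10, e000, e001, e011, e100, e101, e111, c000, c001, c011,
      c100, c101, c111, hcomm 0 0, hcomm 0 1, hcomm 1 1]
    field_simp
    ring

lemma scalar_eq (hG : IsMetricAt G y) : scalar G y = 2 * gauss G y := by
  have h2 := hG.det_pos.ne'
  simp only [scalar, hG.ricci_eq, inv_fin_two _ hG.symm.self_of_nhds h2, Fin.sum_univ_two,
    hG.symm.self_of_nhds]
  have h2' : G y 1 1 * G y 0 0 - G y 0 1 ^ 2 ≠ 0 := by rwa [mul_comm]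
  simp
  field_simp
  ring

end IsMetricAt

/-! ### The Laplacian and conformal changes of metric -/

namespace IsMetricAt

variable {G G' : Plane → Matrix (Fin 2) (Fin 2) ℝ} {y : Plane} {u f : Plane → ℝ}

lemma laplacian_eq (hG : IsMetricAt G y) (hf : ContDiffAt ℝ 2 f y) :
    laplacian G f y = (G y 1 1 * (pd 0 (pd 0 f) y - christoffel G 0 0 0 y * pd 0 f y -
        christoffel G 1 0 0 y * pd 1 f y) -
      2 * G y 0 1 * (pd 0 (pd 1 f) y - christoffel G 0 0 1 y * pd 0 f y -
        christoffel G 1 0 1 y * pd 1 f y) +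
      G y 0 0 * (pd 1 (pd 1 f) y - christoffel G 0 1 1 y * pd 0 f y -
        christoffel G 1 1 1 y * pd 1 f y)) / (G y 0 0 * G y 1 1 - G y 0 1 ^ 2) := by
  have h2 := hG.det_pos.ne'
  simp only [laplacian, inv_fin_two _ hG.symm.self_of_nhds h2, Fin.sum_univ_two,
    hG.christoffel_eq.1, pd_comm hf 1 0]
  simp
  ring

section Conformal

variable (hG : IsMetricAt G y) (hu : ContDiffAt ℝ 2 u y)
  (h : ∀ i j, (fun z => G' z i j) =ᶠ[𝓝 y] fun z => Real.exp (u z) * G z i j)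
include hG hu h

lemma pd_conformal (i j k : Fin 2) : pd k (fun z => G' z i j) y =
    Real.exp (u y) * (pd k (fun z => G z i j) y + pd k u y * G y i j) := by
  have hu' := hu.differentiableAt (by norm_num)
  have hg := (hG.contDiffAt i j).differentiableAt (by norm_num)
  rw [pd_congr (h i j), pd_mul hu'.exp hg, pd_comp (Real.hasDerivAt_exp _) hu']
  ring

lemma pd_pd_conformal (i j k l : Fin 2) : pd l (pd k (fun z => G' z i j)) y =
    Real.exp (u y) * (pd l (pd k (fun z => G z i j)) y + pd k u y * pd l (fun z => G z i j) y +
      pd l u y * pd k (fun z => G z i j) y +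
      (pd l (pd k u) y + pd l u y * pd k u y) * G y i j) := by
  have hev : pd k (fun z => G' z i j) =ᶠ[𝓝 y] fun z =>
      Real.exp (u z) * (pd k (fun z => G z i j) z + pd k u z * G z i j) := by
    have h' : ∀ᶠ z in 𝓝 y, ∀ i j,
        (fun z => G' z i j) =ᶠ[𝓝 z] fun z => Real.exp (u z) * G z i j := by
      simp only [Filter.eventually_all]
      exact fun i j => (h i j).eventuallyEq_nhds
    filter_upwards [hG.eventually, hu.eventually (by simp), h'] with z h1 h2 h3
    exact h1.pd_conformal h2 h3 i j k
  have hu' := hu.differentiableAt (by norm_num)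
  have hg := (hG.contDiffAt i j).differentiableAt (by norm_num)
  have hpu : DifferentiableAt ℝ (pd k u) y :=
    (contDiffAt_pd (m := 1) hu (by norm_num) k).differentiableAt (by norm_num)
  have hpg : DifferentiableAt ℝ (pd k (fun z => G z i j)) y :=
    (contDiffAt_pd (m := 1) (hG.contDiffAt i j) (by norm_num) k).differentiableAt (by norm_num)
  rw [pd_congr hev, pd_mul hu'.exp (hpg.fun_add (hpu.fun_mul hg)),
    pd_comp (Real.hasDerivAt_exp _) hu', pd_add hpg (hpu.fun_mul hg), pd_mul hpu hg]
  ring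

/-- The behaviour of the Gauss curvature under a conformal change of the metric. -/
lemma gauss_conformal : gauss G' y = Real.exp (-u y) * (gauss G y - laplacian G u y / 2) := by
  have h2 := hG.det_pos.ne'
  have h2' : G y 1 1 * G y 0 0 - G y 0 1 ^ 2 ≠ 0 := by rwa [mul_comm]
  obtain ⟨c10, c000, c001, c011, c100, c101, c111⟩ := hG.christoffel_eq
  rw [hG.laplacian_eq hu, c000, c001, c011, c100, c101, c111]
  have he := (Real.exp_pos (u y)).ne'
  have hdet : Real.exp (u y) * G y 0 0 * (Real.exp (u y) * G y 1 1) -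
      (Real.exp (u y) * G y 0 1) ^ 2 =
      Real.exp (u y) ^ 2 * (G y 0 0 * G y 1 1 - G y 0 1 ^ 2) := by ring
  simp only [gauss, brioschi, hG.pd_conformal hu h, hG.pd_pd_conformal hu h,
    fun i j => (h i j).self_of_nhds, Real.exp_neg, hdet]
  field_simp
  ring

/-- In dimension two the Laplacian is conformally covariant. -/
lemma laplacian_conformal (hG' : IsMetricAt G' y) (hf : ContDiffAt ℝ 2 f y) :
    laplacian G' f y = Real.exp (-u y) * laplacian G f y := by
  have h2 := hG.det_pos.ne'
  have h2' : G y 1 1 * G y 0 0 - G y 0 1 ^ 2 ≠ 0 := by rwa [mul_comm]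
  obtain ⟨c10, c000, c001, c011, c100, c101, c111⟩ := hG.christoffel_eq
  obtain ⟨c10', c000', c001', c011', c100', c101', c111'⟩ := hG'.christoffel_eq
  rw [hG.laplacian_eq hf, c000, c001, c011, c100, c101, c111, hG'.laplacian_eq hf, c000', c001',
    c011', c100', c101', c111']
  have he := (Real.exp_pos (u y)).ne'
  have hdet : Real.exp (u y) * G y 0 0 * (Real.exp (u y) * G y 1 1) -
      (Real.exp (u y) * G y 0 1) ^ 2 =
      Real.exp (u y) ^ 2 * (G y 0 0 * G y 1 1 - G y 0 1 ^ 2) := by ring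
  simp only [hG.pd_conformal hu h, fun i j => (h i j).self_of_nhds, Real.exp_neg, hdet]
  field_simp
  ring

end Conformal

end IsMetricAt

/-! ### Rules for the Laplacian and its sign at a maximum -/

lemma laplacian_congr {G : Plane → Matrix (Fin 2) (Fin 2) ℝ} {f h : Plane → ℝ} {y : Plane}
    (hfh : f =ᶠ[𝓝 y] h) : laplacian G f y = laplacian G h y := by
  simp only [laplacian, pd_congr hfh, pd_congr (pd_eventuallyEq hfh _)]

lemma laplacian_sub {G : Plane → Matrix (Fin 2) (Fin 2) ℝ} {f h : Plane → ℝ} {y : Plane}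
    (hf : ContDiffAt ℝ 2 f y) (hh : ContDiffAt ℝ 2 h y) (a b c : ℝ) :
    laplacian G (fun z => a * f z - b * (h z + c)) y =
      a * laplacian G f y - b * laplacian G h y := by
  -- The summand 0 keeps the shape of the original function, so that the same rule applies again, to
  -- first derivatives and with constant 0.
  have hp : ∀ {f h : Plane → ℝ} {y : Plane} (i : Fin 2), DifferentiableAt ℝ f y →
      DifferentiableAt ℝ h y → ∀ c, pd i (fun z => a * f z - b * (h z + c)) y =
        a * pd i f y - b * (pd i h y + 0) := by
    intro f h y i hf hh c
    rw [pd_sub (hf.const_mul a) ((hh.add_const c).const_mul b), pd_const_mul hf,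
      pd_const_mul (hh.add_const c), pd_add hh (by fun_prop), pd_const]
  have h1 : ∀ i, pd i (fun z => a * f z - b * (h z + c)) y =
      a * pd i f y - b * (pd i h y + 0) := fun i =>
    hp i (hf.differentiableAt (by norm_num)) (hh.differentiableAt (by norm_num)) c
  have h2 : ∀ i j, pd i (pd j (fun z => a * f z - b * (h z + c))) y =
      a * pd i (pd j f) y - b * (pd i (pd j h) y + 0) := by
    intro i j
    have : pd j (fun z => a * f z - b * (h z + c)) =ᶠ[𝓝 y]
        fun z => a * pd j f z - b * (pd j h z + 0) := by
      filter_upwards [hf.eventually (by simp), hh.eventually (by simp)] with z h1 h2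
      exact hp j (h1.differentiableAt (by norm_num)) (h2.differentiableAt (by norm_num)) c
    rw [pd_congr this]
    exact hp i ((contDiffAt_pd (m := 1) hf (by norm_num) j).differentiableAt (by norm_num))
      ((contDiffAt_pd (m := 1) hh (by norm_num) j).differentiableAt (by norm_num)) 0
  simp only [laplacian, h1, h2, Fin.sum_univ_two]
  ring

/-- Were the second derivative positive, the point would also be a local minimum; then p would be
locally constant and its second derivative zero. -/
lemma deriv_deriv_nonpos_of_isLocalMax {p : ℝ → ℝ} {t : ℝ} (h : IsLocalMax p t)
    (hc : ContinuousAt p t) : deriv (deriv p) t ≤ 0 := by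
  by_contra! hpos
  have hmin := isLocalMin_of_deriv_deriv_pos hpos h.deriv_eq_zero hc
  have hconst : p =ᶠ[𝓝 t] fun _ => p t := by
    filter_upwards [h, hmin] with s h1 h2 using le_antisymm h1 h2
  have : deriv (deriv p) t = 0 := by
    rw [hconst.deriv.deriv_eq]; simp
  linarith

lemma hessian_nonpos_of_isLocalMax {f : Plane → ℝ} {y : Plane} (h : IsLocalMax f y)
    (hf : ContDiffAt ℝ 2 f y) (a b : ℝ) :
    a ^ 2 * pd 0 (pd 0 f) y + 2 * a * b * pd 0 (pd 1 f) y + b ^ 2 * pd 1 (pd 1 f) y ≤ 0 := by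
  set v : Plane := a • EuclideanSpace.single 0 1 + b • EuclideanSpace.single 1 1 with hv
  have hline : ∀ s, HasDerivAt (fun s : ℝ => y + s • v) v s := fun s => by
    simpa using ((hasDerivAt_id s).smul_const v).const_add y
  have ht : Filter.Tendsto (fun s : ℝ => y + s • v) (𝓝 0) (𝓝 y) := by
    simpa using (hline 0).continuousAt.tendsto
  have hd : ∀ {f : Plane → ℝ} {s : ℝ}, DifferentiableAt ℝ f (y + s • v) →
      HasDerivAt (fun s : ℝ => f (y + s • v))
        (a * pd 0 f (y + s • v) + b * pd 1 f (y + s • v)) s := by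
    intro f s hf
    have hL : fderiv ℝ f (y + s • v) v = a * pd 0 f (y + s • v) + b * pd 1 f (y + s • v) := by
      rw [pd, pd, ← smul_eq_mul, ← smul_eq_mul, ← map_smul, ← map_smul, ← map_add]
    rw [← hL]
    exact hf.hasFDerivAt.comp_hasDerivAt s (hline s)
  have h1 : deriv (fun s : ℝ => f (y + s • v)) =ᶠ[𝓝 0]
      fun s => a * pd 0 f (y + s • v) + b * pd 1 f (y + s • v) := by
    filter_upwards [ht.eventually (hf.eventually (by simp))] with s hs
    exact (hd (hs.differentiableAt (by norm_num))).deriv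
  have hp : ∀ i, DifferentiableAt ℝ (pd i f) (y + (0 : ℝ) • v) := fun i => by
    simpa using (contDiffAt_pd (m := 1) hf (by norm_num) i).differentiableAt (by norm_num)
  have h2 : deriv (deriv (fun s : ℝ => f (y + s • v))) 0 =
      a * (a * pd 0 (pd 0 f) y + b * pd 1 (pd 0 f) y) +
      b * (a * pd 0 (pd 1 f) y + b * pd 1 (pd 1 f) y) := by
    rw [h1.deriv_eq, (((hd (hp 0)).const_mul a).fun_add ((hd (hp 1)).const_mul b)).deriv]
    simp
  have hmax : IsLocalMax (fun s : ℝ => f (y + s • v)) 0 := by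
    have := ht.eventually h
    filter_upwards [this] with s hs
    simpa using hs
  have h3 := deriv_deriv_nonpos_of_isLocalMax hmax
    (hd (by simpa using hf.differentiableAt (by norm_num))).continuousAt
  rw [h2, pd_comm hf 1 0] at h3
  linarith

lemma laplacian_nonpos_of_isLocalMax {G : Plane → Matrix (Fin 2) (Fin 2) ℝ} {f : Plane → ℝ}
    {y : Plane} (hG : IsMetricAt G y) (h : IsLocalMax f y) (hf : ContDiffAt ℝ 2 f y) :
    laplacian G f y ≤ 0 := by
  have hp : ∀ i, pd i f y = 0 := fun i => by simp [pd, h.fderiv_eq_zero]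
  rw [hG.laplacian_eq hf, hp, hp]
  apply div_nonpos_of_nonpos_of_nonneg _ hG.det_pos.le
  have hpos := hG.pos
  have hdet := hG.det_pos
  have h1 := hessian_nonpos_of_isLocalMax h hf (-(G y 0 1)) (G y 0 0)
  have h2 := hessian_nonpos_of_isLocalMax h hf 1 0
  -- Completing the square: with E, F, D the components of the metric, E (D f₀₀ - 2F f₀₁ + E f₁₁) is
  -- the Hessian on the vector (-F, E) plus (ED - F²) f₀₀.
  have h3 : G y 0 0 * (G y 1 1 * pd 0 (pd 0 f) y - 2 * G y 0 1 * pd 0 (pd 1 f) y +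
      G y 0 0 * pd 1 (pd 1 f) y) ≤ 0 := by
    have : (G y 0 0 * G y 1 1 - G y 0 1 ^ 2) * pd 0 (pd 0 f) y ≤ 0 :=
      mul_nonpos_of_nonneg_of_nonpos hdet.le (by linarith)
    nlinarith
  have := nonpos_of_mul_nonpos_right h3 hpos
  linarith

/-! ### Time-dependent functions on the plane -/

section TimeDependent

variable {f : ℝ × Plane → ℝ} {t : ℝ} {y : Plane}

lemma pd_slice_eq (hf : DifferentiableAt ℝ f (t, y)) (i : Fin 2) :
    pd i (fun z => f (t, z)) y = fderiv ℝ f (t, y) (0, EuclideanSpace.single i 1) := by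
  have h := hf.hasFDerivAt.comp y (hasFDerivAt_prodMk_right t y)
  simp only [pd]
  change fderiv ℝ (f ∘ fun z => (t, z)) y _ = _
  rw [h.fderiv]; simp

lemma deriv_slice_eq (hf : DifferentiableAt ℝ f (t, y)) :
    deriv (fun s => f (s, y)) t = fderiv ℝ f (t, y) (1, 0) := by
  have h := (hf.hasFDerivAt.comp t (hasFDerivAt_prodMk_left t y)).hasDerivAt
  change deriv (f ∘ fun s => (s, y)) t = _
  rw [h.deriv]; simp

lemma contDiffAt_pd_slice {n m : ℕ} (hf : ContDiffAt ℝ n f (t, y)) (hm : m + 1 ≤ n) (i : Fin 2) :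
    ContDiffAt ℝ m (fun p : ℝ × Plane => pd i (fun z => f (p.1, z)) p.2) (t, y) := by
  have h1 : ContDiffAt ℝ m (fun p : ℝ × Plane =>
      fderiv ℝ f p (0, EuclideanSpace.single i 1)) (t, y) :=
    (hf.fderiv_right (by exact_mod_cast hm)).clm_apply contDiffAt_const
  refine h1.congr_of_eventuallyEq ?_
  filter_upwards [hf.eventually (by simp)] with p hp
  exact pd_slice_eq (hp.differentiableAt (by norm_cast; lia)) i

/-- Time and space derivatives commute by the symmetry of the second derivative of f on the product,
evaluated on (1, 0) and (0, eᵢ). -/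
lemma hasDerivAt_pd_slice (hf : ContDiffAt ℝ 2 f (t, y)) (i : Fin 2) :
    HasDerivAt (fun s => pd i (fun z => f (s, z)) y)
      (pd i (fun z => deriv (fun s => f (s, z)) t) y) t := by
  have hd : DifferentiableAt ℝ (fderiv ℝ f) (t, y) :=
    (hf.fderiv_right (m := 1) (by norm_num)).differentiableAt (by norm_num)
  have hs := hf.isSymmSndFDerivAt (by simp)
  have hev : ∀ᶠ p in 𝓝 (t, y), DifferentiableAt ℝ f p :=
    (hf.eventually (by simp)).mono fun p hp => hp.differentiableAt (by norm_num)
  have ht : Filter.Tendsto (fun s : ℝ => (s, y)) (𝓝 t) (𝓝 (t, y)) :=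
    (Continuous.prodMk_left y).tendsto t
  have hy : Filter.Tendsto (fun z : Plane => (t, z)) (𝓝 y) (𝓝 (t, y)) :=
    (Continuous.prodMk_right t).tendsto y
  have e1 : (fun s => pd i (fun z => f (s, z)) y) =ᶠ[𝓝 t]
      fun s => fderiv ℝ f (s, y) (0, EuclideanSpace.single i 1) :=
    (ht.eventually hev).mono fun s h => pd_slice_eq h i
  have e2 : (fun z => deriv (fun s => f (s, z)) t) =ᶠ[𝓝 y]
      fun z => fderiv ℝ f (t, z) (1, 0) :=
    (hy.eventually hev).mono fun s h => deriv_slice_eq h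
  have h1 : ∀ v, HasFDerivAt (fun p : ℝ × Plane => fderiv ℝ f p v)
      ((fderiv ℝ (fderiv ℝ f) (t, y)).flip v) (t, y) := fun v => by
    have := hd.hasFDerivAt.clm_apply (hasFDerivAt_const v (t, y))
    simpa using this
  have h2 := ((h1 (0, EuclideanSpace.single i 1)).comp t (hasFDerivAt_prodMk_left t y)).hasDerivAt
  have h3 := ((h1 (1, 0)).comp y (hasFDerivAt_prodMk_right t y)).fderiv
  rw [pd_congr e2]
  refine HasDerivAt.congr_of_eventuallyEq (h2.congr_deriv ?_) e1
  simp only [pd]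
  symm
  change fderiv ℝ ((fun p : ℝ × Plane => fderiv ℝ f p (1, 0)) ∘ fun z => (t, z)) y _ = _
  rw [h3]
  simp [hs.eq]

lemma hasDerivAt_pd_pd_slice (hf : ContDiffAt ℝ 3 f (t, y)) (i j : Fin 2) :
    HasDerivAt (fun s => pd j (pd i (fun z => f (s, z))) y)
      (pd j (pd i (fun z => deriv (fun s => f (s, z)) t)) y) t := by
  have h1 := hasDerivAt_pd_slice (contDiffAt_pd_slice (n := 3) (m := 2) hf (by norm_num) i) j
  have hy : Filter.Tendsto (fun z : Plane => (t, z)) (𝓝 y) (𝓝 (t, y)) :=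
    (Continuous.prodMk_right t).tendsto y
  have h2 : (fun z => deriv (fun s => pd i (fun z => f (s, z)) z) t) =ᶠ[𝓝 y]
      pd i (fun z => deriv (fun s => f (s, z)) t) := by
    filter_upwards [hy.eventually (hf.eventually (by simp))] with z hz
    exact (hasDerivAt_pd_slice (hz.of_le (by norm_num)) i).deriv
  rwa [pd_congr h2] at h1

/-- The metric is frozen. This is enough for the evolution of R, where curvatures at nearby times
are expressed through the Laplacian of one time. -/
lemma hasDerivAt_laplacian_slice (G : Plane → Matrix (Fin 2) (Fin 2) ℝ)
    (hf : ContDiffAt ℝ 3 f (t, y)) :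
    HasDerivAt (fun s => laplacian G (fun z => f (s, z)) y)
      (laplacian G (fun z => deriv (fun s => f (s, z)) t) y) t := by
  unfold laplacian
  refine HasDerivAt.fun_sum fun i _ => HasDerivAt.fun_sum fun j _ => HasDerivAt.const_mul _ ?_
  refine (hasDerivAt_pd_pd_slice hf j i).fun_sub (HasDerivAt.fun_sum fun k _ => ?_)
  exact (hasDerivAt_pd_slice (hf.of_le (by norm_num)) k).const_mul _

end TimeDependent

/-! ### The Ricci flow in a coordinate domain -/

/-- The family of metrics with components `G t` is a classical solution of the Ricci flow on the
open subset `U` of the plane. -/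
structure IsPlaneFlow (G : ℝ → Plane → Matrix (Fin 2) (Fin 2) ℝ) (U : Set Plane) : Prop where
  isOpen : IsOpen U
  isMetricAt : ∀ t, ∀ y ∈ U, IsMetricAt (G t) y
  smooth : ∀ i j : Fin 2, ContDiffOn ℝ ∞ (fun p : ℝ × Plane => G p.1 p.2 i j) (Set.Ioi 0 ×ˢ U)
  continuous_zero : ∀ i j : Fin 2,
    ContinuousOn (fun p : ℝ × Plane => G p.1 p.2 i j) (Set.Ici 0 ×ˢ U)
  continuous_one : ∀ i j k : Fin 2,
    ContinuousOn (fun p : ℝ × Plane => pd k (fun z => G p.1 z i j) p.2) (Set.Ici 0 ×ˢ U)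
  continuous_two : ∀ i j k l : Fin 2,
    ContinuousOn (fun p : ℝ × Plane => pd l (pd k (fun z => G p.1 z i j)) p.2) (Set.Ici 0 ×ˢ U)
  equation : ∀ i j : Fin 2, ∀ t : ℝ, 0 < t → ∀ y ∈ U,
    HasDerivAt (fun s => G s y i j) (-2 * ricci (G t) i j y) t

namespace IsPlaneFlow

variable {G : ℝ → Plane → Matrix (Fin 2) (Fin 2) ℝ} {U : Set Plane} {t s T K B : ℝ} {y : Plane}
  {f : Plane → ℝ}

lemma hasDerivAt (h : IsPlaneFlow G U) (ht : 0 < t) (hy : y ∈ U) (i j : Fin 2) :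
    HasDerivAt (fun s => G s y i j) (-scalar (G t) y * G t y i j) t := by
  have hm := h.isMetricAt t y hy
  convert h.equation i j t ht y hy using 1
  rw [hm.ricci_eq, hm.scalar_eq]; ring

lemma continuousOn_time (h : IsPlaneFlow G U) (hy : y ∈ U) (i j : Fin 2) :
    ContinuousOn (fun s => G s y i j) (Set.Ici 0) :=
  (h.continuous_zero i j).comp (f := fun s : ℝ => (s, y)) (by fun_prop) fun _ hs => ⟨hs, hy⟩

/-- By Brioschi's formula R is a rational function of the 2-jet of the metric, and this jet is
continuous up to t = 0. -/
lemma continuousOn_scalar (h : IsPlaneFlow G U) :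
    ContinuousOn (fun p : ℝ × Plane => scalar (G p.1) p.2) (Set.Ici 0 ×ˢ U) := by
  have h1 : ContinuousOn (fun p : ℝ × Plane => 2 * gauss (G p.1) p.2) (Set.Ici 0 ×ˢ U) := by
    have h0 := h.continuous_zero
    have h1 := h.continuous_one
    have h2 := h.continuous_two
    have hne : ∀ p ∈ Set.Ici 0 ×ˢ U,
        (G p.1 p.2 0 0 * G p.1 p.2 1 1 - G p.1 p.2 0 1 ^ 2) ^ 2 ≠ 0 := fun p hp =>
      pow_ne_zero 2 (h.isMetricAt p.1 p.2 hp.2).det_pos.ne'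
    unfold gauss brioschi
    fun_prop (disch := assumption)
  exact h1.congr fun p hp => (h.isMetricAt p.1 p.2 hp.2).scalar_eq

/-- The metrics of a two-dimensional Ricci flow are conformal to each other. -/
lemma conformal (h : IsPlaneFlow G U) (ht : 0 ≤ t) (hs : 0 ≤ s) (hy : y ∈ U) (i j : Fin 2) :
    G t y i j = Real.exp (Real.log (G t y 0 0 / G s y 0 0)) * G s y i j := by
  have hpos : ∀ r, 0 < G r y 0 0 := fun r => (h.isMetricAt r y hy).pos
  -- All components solve the same linear equation x' = -R x, so their quotients are constant in
  -- time.
  set q : ℝ → ℝ := fun r => G r y i j / G r y 0 0 with hq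
  have hc : ContinuousOn q (Set.Ici 0) :=
    (h.continuousOn_time hy i j).div (h.continuousOn_time hy 0 0) fun r _ => (hpos r).ne'
  have hd : ∀ r ∈ interior (Set.Ici (0 : ℝ)), HasDerivAt q 0 r := by
    intro r hr
    rw [interior_Ici] at hr
    have hne := (hpos r).ne'
    refine ((h.hasDerivAt hr hy i j).fun_div (h.hasDerivAt hr hy 0 0) hne).congr_deriv ?_
    field_simp
    ring
  have hd' : DifferentiableOn ℝ q (interior (Set.Ici (0 : ℝ))) := fun r hr =>
    (hd r hr).differentiableAt.differentiableWithinAt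
  have h1 := monotoneOn_of_deriv_nonneg (convex_Ici 0) hc hd' fun r hr => (hd r hr).deriv.ge
  have h2 := antitoneOn_of_deriv_nonpos (convex_Ici 0) hc hd' fun r hr => (hd r hr).deriv.le
  have h3 : q t = q s := by
    rcases le_total t s with hts | hts
    · exact le_antisymm (h1 ht hs hts) (h2 ht hs hts)
    · exact le_antisymm (h2 hs ht hts) (h1 hs ht hts)
  rw [Real.exp_log (div_pos (hpos t) (hpos s))]
  have hne := (hpos t).ne'
  have hne' := (hpos s).ne'
  simp only [hq] at h3
  field_simp at h3 ⊢
  linarith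

lemma contDiffAt_log (h : IsPlaneFlow G U) (hy : y ∈ U) :
    ContDiffAt ℝ 2 (fun z => Real.log (G t z 0 0 / G s z 0 0)) y := by
  have hpos : ∀ r, 0 < G r y 0 0 := fun r => (h.isMetricAt r y hy).pos
  exact (((h.isMetricAt t y hy).contDiffAt 0 0).div ((h.isMetricAt s y hy).contDiffAt 0 0)
    (hpos s).ne').log (div_pos (hpos t) (hpos s)).ne'

/-- The derivative of e^{Kr} G is e^{Kr}(K - R)G ≥ 0. -/
lemma component_le (h : IsPlaneFlow G U) (hy : y ∈ U) (ht : t ∈ Set.Icc 0 T)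
    (hK : ∀ r ∈ Set.Icc 0 T, scalar (G r) y ≤ K) (hK0 : 0 ≤ K) :
    G 0 y 0 0 ≤ Real.exp (K * T) * G t y 0 0 := by
  have hpos : ∀ r, 0 < G r y 0 0 := fun r => (h.isMetricAt r y hy).pos
  have hd : ∀ r ∈ interior (Set.Icc 0 T), HasDerivAt (fun r => Real.exp (K * r) * G r y 0 0)
      (Real.exp (K * r) * ((K - scalar (G r) y) * G r y 0 0)) r := by
    intro r hr
    rw [interior_Icc] at hr
    refine ((((hasDerivAt_id r).const_mul K).exp).fun_mul
      (h.hasDerivAt hr.1 hy 0 0)).congr_deriv ?_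
    simp
    ring
  have hmono : MonotoneOn (fun r => Real.exp (K * r) * G r y 0 0) (Set.Icc 0 T) := by
    apply monotoneOn_of_deriv_nonneg (convex_Icc 0 T)
    · exact (Continuous.continuousOn (by fun_prop)).mul
        ((h.continuousOn_time hy 0 0).mono Set.Icc_subset_Ici_self)
    · exact fun r hr => (hd r hr).differentiableAt.differentiableWithinAt
    · intro r hr
      rw [(hd r hr).deriv]
      have := hK r (interior_subset hr)
      exact mul_nonneg (Real.exp_pos _).le (mul_nonneg (by linarith) (hpos r).le)
  have := hmono ⟨le_rfl, ht.1.trans ht.2⟩ ht ht.1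
  simp only [mul_zero, Real.exp_zero, one_mul] at this
  refine this.trans (mul_le_mul_of_nonneg_right ?_ (hpos t).le)
  exact Real.exp_le_exp.2 (mul_le_mul_of_nonneg_left ht.2 hK0)

lemma laplacian_le (h : IsPlaneFlow G U) (hy : y ∈ U) (ht : t ∈ Set.Icc 0 T)
    (hK : ∀ r ∈ Set.Icc 0 T, scalar (G r) y ≤ K) (hK0 : 0 ≤ K) (hf : ContDiffAt ℝ 2 f y)
    (hB : laplacian (G 0) f y ≤ B) (hB0 : 0 ≤ B) :
    laplacian (G t) f y ≤ Real.exp (K * T) * B := by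
  have hpos : ∀ r, 0 < G r y 0 0 := fun r => (h.isMetricAt r y hy).pos
  rw [(h.isMetricAt 0 y hy).laplacian_conformal (h.contDiffAt_log hy)
    (fun i j => (h.isOpen.eventually_mem hy).mono fun z hz => h.conformal ht.1 le_rfl hz i j)
    (h.isMetricAt t y hy) hf, Real.exp_neg, Real.exp_log (div_pos (hpos t) (hpos 0)), inv_div]
  have h1 : G 0 y 0 0 / G t y 0 0 ≤ Real.exp (K * T) := by
    rw [div_le_iff₀ (hpos t)]
    exact h.component_le hy ht hK hK0
  exact (mul_le_mul_of_nonneg_left hB (div_pos (hpos 0) (hpos t)).le).trans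
    (mul_le_mul_of_nonneg_right h1 hB0)

lemma contDiffAt (h : IsPlaneFlow G U) (ht : 0 < t) (hy : y ∈ U) (i j : Fin 2) :
    ContDiffAt ℝ ∞ (fun p : ℝ × Plane => G p.1 p.2 i j) (t, y) :=
  (h.smooth i j).contDiffAt ((isOpen_Ioi.prod h.isOpen).mem_nhds ⟨ht, hy⟩)

/-- The scalar curvature is smooth in space at positive times. -/
lemma contDiffAt_scalar (h : IsPlaneFlow G U) (ht : 0 < t) (hy : y ∈ U) :
    ContDiffAt ℝ 2 (scalar (G t)) y := by
  have h0 : ∀ i j, ContDiffAt ℝ 4 (fun z => G t z i j) y := fun i j =>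
    contDiffAt_infty.1
      ((h.contDiffAt ht hy i j).comp y (f := fun z => (t, z)) (by fun_prop)) 4
  have h0' : ∀ i j, ContDiffAt ℝ 2 (fun z => G t z i j) y := fun i j =>
    (h0 i j).of_le (by norm_num)
  have h1 : ∀ i j k, ContDiffAt ℝ 3 (pd k (fun z => G t z i j)) y := fun i j k =>
    contDiffAt_pd (h0 i j) (by norm_num) k
  have h1' : ∀ i j k, ContDiffAt ℝ 2 (pd k (fun z => G t z i j)) y := fun i j k =>
    (h1 i j k).of_le (by norm_num)
  have h2 : ∀ i j k l, ContDiffAt ℝ 2 (pd l (pd k (fun z => G t z i j))) y := fun i j k l =>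
    contDiffAt_pd (h1 i j k) (by norm_num) l
  have hne : (G t y 0 0 * G t y 1 1 - G t y 0 1 ^ 2) ^ 2 ≠ 0 :=
    pow_ne_zero 2 (h.isMetricAt t y hy).det_pos.ne'
  have h3 : ContDiffAt ℝ 2 (fun z => 2 * gauss (G t) z) y := by
    unfold gauss brioschi
    fun_prop (disch := assumption)
  refine h3.congr_of_eventuallyEq ?_
  filter_upwards [h.isOpen.mem_nhds hy] with z hz using (h.isMetricAt t z hz).scalar_eq

/-- The evolution equation of the scalar curvature, `∂ₜ R = Δ R + R²`. -/
lemma hasDerivAt_scalar (h : IsPlaneFlow G U) (ht : 0 < t) (hy : y ∈ U) :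
    HasDerivAt (fun s => scalar (G s) y)
      (laplacian (G t) (scalar (G t)) y + scalar (G t) y ^ 2) t := by
  have hpos : ∀ r, ∀ z ∈ U, 0 < G r z 0 0 := fun r z hz => (h.isMetricAt r z hz).pos
  -- u is the logarithm of the conformal factor relative to the fixed time t, so R(s) = e^{-u}(R(t)
  -- - Δₜu). Since u = 0 and ∂ₛu = -R at s = t, differentiating there gives R² + ΔR.
  set u : ℝ × Plane → ℝ := fun p => Real.log (G p.1 p.2 0 0 / G t p.2 0 0) with hu
  have huc : ContDiffAt ℝ 3 u (t, y) := by
    have h1 := h.contDiffAt ht hy 0 0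
    have h2 : ContDiffAt ℝ ∞ (fun p : ℝ × Plane => G t p.2 0 0) (t, y) :=
      ContDiffAt.comp (g := fun p : ℝ × Plane => G p.1 p.2 0 0) (f := fun p => (t, p.2)) (t, y) h1
        (by fun_prop)
    exact contDiffAt_infty.1 ((h1.div h2 (hpos t y hy).ne').log
      (div_pos (hpos t y hy) (hpos t y hy)).ne') 3
  have hut : ∀ z ∈ U, HasDerivAt (fun s => u (s, z)) (-scalar (G t) z) t := by
    intro z hz
    have hne := (hpos t z hz).ne'
    refine (((h.hasDerivAt ht hz 0 0).div_const (G t z 0 0)).log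
      (div_ne_zero hne hne)).congr_deriv ?_
    field_simp
  have hu0 : ∀ z ∈ U, u (t, z) = 0 := fun z hz => by
    simp [hu]
  have hR : (fun s => scalar (G s) y) =ᶠ[𝓝 t] fun s =>
      Real.exp (-u (s, y)) * (scalar (G t) y - laplacian (G t) (fun z => u (s, z)) y) := by
    filter_upwards [lt_mem_nhds ht] with s hs
    rw [(h.isMetricAt s y hy).scalar_eq, (h.isMetricAt t y hy).scalar_eq,
      (h.isMetricAt t y hy).gauss_conformal (h.contDiffAt_log (t := s) (s := t) hy)
      (fun i j => (h.isOpen.eventually_mem hy).mono fun z hz => h.conformal hs.le ht.le hz i j)]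
    ring
  have h1 := (((hut y hy).fun_neg).exp).fun_mul
    ((hasDerivAt_const t (scalar (G t) y)).fun_sub (hasDerivAt_laplacian_slice (G t) huc))
  refine HasDerivAt.congr_of_eventuallyEq (h1.congr_deriv ?_) hR
  have e1 : laplacian (G t) (fun z => u (t, z)) y = 0 := by
    have : (fun z => u (t, z)) =ᶠ[𝓝 y] fun _ => (0 : ℝ) :=
      (h.isOpen.eventually_mem hy).mono hu0
    rw [laplacian_congr this]
    have hp : ∀ i, pd i (fun _ => (0 : ℝ)) = fun _ => 0 := fun i => by
      funext z; exact pd_const i 0 z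
    simp [laplacian, hp]
  have e2 : laplacian (G t) (fun z => deriv (fun s => u (s, z)) t) y =
      - laplacian (G t) (scalar (G t)) y := by
    have : (fun z => deriv (fun s => u (s, z)) t) =ᶠ[𝓝 y] fun z => - scalar (G t) z :=
      (h.isOpen.eventually_mem hy).mono fun z hz => (hut z hz).deriv
    rw [laplacian_congr this]
    have hp : ∀ (k : Plane → ℝ) i, pd i (fun z => - k z) = fun z => - pd i k z := fun k i => by
      funext z; exact pd_neg k z i
    simp only [laplacian, hp, Fin.sum_univ_two]
    ring
  rw [e1, e2, hu0 y hy]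
  simp
  ring

end IsPlaneFlow

/-! ### The flow in charts, and chart independence of the scalar curvature -/

section Surface

variable {M : Type*} [TopologicalSpace M] [ChartedSpace Plane M] [IsManifold (𝓡 2) ∞ M]
  {g : ℝ → Metric M} {e : OpenPartialHomeomorph M Plane}

omit [IsManifold (𝓡 2) ∞ M] in
lemma mdifferentiable_of_mem_maximalAtlas (he : e ∈ IsManifold.maximalAtlas (𝓡 2) ∞ M) :
    e.MDifferentiable (𝓡 2) (𝓡 2) :=
  ⟨(contMDiffOn_of_mem_maximalAtlas he).mdifferentiableOn (by simp),
    (contMDiffOn_symm_of_mem_maximalAtlas he).mdifferentiableOn (by simp)⟩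

/-- The vectors dΦ(eᵢ) form a smooth field along Φ, the image of a constant section under the
tangent map; pairing two such fields by a C² metric gives a C² function. -/
lemma contDiffAt_comp (g : Metric M) {Φ : Plane → M} {y : Plane}
    (hΦ : ∀ᶠ z in 𝓝 y, ContMDiffAt (𝓡 2) (𝓡 2) ∞ Φ z) (i j : Fin 2) :
    ContDiffAt ℝ 2 (fun z => comp g Φ z i j) y := by
  obtain ⟨s, hs, hso, hys⟩ := mem_nhds_iff.1 hΦ
  have hon : ContMDiffOn (𝓡 2) (𝓡 2) ∞ Φ s := fun z hz => (hs hz).contMDiffWithinAt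
  have hT := hon.contMDiffOn_tangentMapWithin (m := 2) (by norm_cast) hso.uniqueMDiffOn
  have hv : ∀ i : Fin 2, ContMDiffAt (𝓡 2) (𝓡 2).tangent 2
      (fun z => Bundle.TotalSpace.mk' Plane (E := fun x : M => TangentSpace (𝓡 2) x) (Φ z)
        (mfderiv (𝓡 2) (𝓡 2) Φ z (EuclideanSpace.single i (1 : ℝ) : Plane))) y := by
    intro i
    have hsec : ContMDiff (𝓡 2) (𝓡 2).tangent 2 (fun z : Plane =>
        (⟨z, (EuclideanSpace.single i (1 : ℝ) : Plane)⟩ : TangentBundle (𝓡 2) Plane)) :=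
      contMDiff_vectorSpace_iff_contDiff.2 contDiff_const
    have h1 := (hT.comp hsec.contMDiffOn (s := s) fun z hz => hz).contMDiffAt (hso.mem_nhds hys)
    refine h1.congr_of_eventuallyEq ?_
    filter_upwards [hso.mem_nhds hys] with z hz
    simp [tangentMapWithin, mfderivWithin_of_isOpen hso hz]
  have hg := (g.contMDiff (Φ y)).comp y ((hs hys).of_le (by norm_cast : (2 : WithTop ℕ∞) ≤ ∞))
  have := ContMDiffAt.clm_bundle_apply₂ (F₁ := Plane) (F₂ := Plane) (F₃ := ℝ)
    (E₃ := fun _ : M => ℝ) hg (hv i) (hv j)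
  rw [Bundle.contMDiffAt_totalSpace] at this
  exact this.2.contDiffAt

lemma isMetricAt_comp (g : Metric M) (he : e ∈ IsManifold.maximalAtlas (𝓡 2) ∞ M) {y : Plane}
    (hy : y ∈ e.target) : IsMetricAt (comp g e.symm) y := by
  have hinj := (mdifferentiable_of_mem_maximalAtlas he).symm.mfderiv_injective
    (x := y) (by simpa using hy)
  have hpos : ∀ a b : ℝ, (a ≠ 0 ∨ b ≠ 0) → 0 < a ^ 2 * comp g e.symm y 0 0 +
      2 * a * b * comp g e.symm y 0 1 + b ^ 2 * comp g e.symm y 1 1 := by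
    intro a b hab
    set v : Plane := a • EuclideanSpace.single 0 1 + b • EuclideanSpace.single 1 1 with hv
    have hv0 : v ≠ 0 := by
      intro h0
      have h1 := congrArg (fun w : Plane => w 0) h0
      have h2 := congrArg (fun w : Plane => w 1) h0
      simp [hv] at h1 h2
      tauto
    have h1 : mfderiv (𝓡 2) (𝓡 2) e.symm y v ≠ 0 := fun h =>
      hv0 (hinj (h.trans (map_zero (mfderiv (𝓡 2) (𝓡 2) e.symm y)).symm))
    have h2 := g.pos _ _ h1
    have h3 : mfderiv (𝓡 2) (𝓡 2) e.symm y v =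
        a • mfderiv (𝓡 2) (𝓡 2) e.symm y (EuclideanSpace.single 0 1 : Plane) +
        b • mfderiv (𝓡 2) (𝓡 2) e.symm y (EuclideanSpace.single 1 1 : Plane) := by
      rw [hv]
      exact (map_add (mfderiv (𝓡 2) (𝓡 2) e.symm y) _ _).trans
        (congrArg₂ _ (map_smul _ _ _) (map_smul _ _ _))
    rw [h3] at h2
    simp only [map_add, map_smul, add_apply, smul_apply,
      smul_eq_mul] at h2
    rw [g.symm (e.symm y) (mfderiv (𝓡 2) (𝓡 2) e.symm y (EuclideanSpace.single 1 1 : Plane))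
      (mfderiv (𝓡 2) (𝓡 2) e.symm y (EuclideanSpace.single 0 1 : Plane))] at h2
    simp only [comp, Matrix.of_apply]
    linarith
  refine ⟨contDiffAt_comp g ?_, .of_forall fun z => g.symm _ _ _, by simpa using hpos 1 0, ?_⟩
  · filter_upwards [e.open_target.mem_nhds hy] with z hz
      using contMDiffAt_symm_of_mem_maximalAtlas he hz
  · have h0 : 0 < comp g e.symm y 0 0 := by simpa using hpos 1 0
    -- On the vector (-F, E) the metric takes the value E (ED - F²), which yields the sign of the
    -- determinant.
    have h1 := hpos (-comp g e.symm y 0 1) (comp g e.symm y 0 0) (Or.inr h0.ne')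
    refine (mul_pos_iff_of_pos_left h0).1 ?_
    linarith

lemma IsRicciFlow.isPlaneFlow (h : IsRicciFlow g) (he : e ∈ IsManifold.maximalAtlas (𝓡 2) ∞ M) :
    IsPlaneFlow (fun t => comp (g t) e.symm) e.target where
  isOpen := e.open_target
  isMetricAt t _ hy := isMetricAt_comp (g t) he hy
  smooth := h.smooth e he
  continuous_zero := h.continuous_zero e he
  continuous_one := h.continuous_one e he
  continuous_two := h.continuous_two e he
  equation := h.equation e he

/-- The Ricci flow equation without coordinates. -/
lemma IsRicciFlow.hasDerivAt_inner (h : IsRicciFlow g)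
    (he : e ∈ IsManifold.maximalAtlas (𝓡 2) ∞ M) {t : ℝ} (ht : 0 < t) {y : Plane}
    (hy : y ∈ e.target) (v w : TangentSpace (𝓡 2) (e.symm y)) :
    HasDerivAt (fun s => (g s).inner (e.symm y) v w)
      (-scalar (comp (g t) e.symm) y * (g t).inner (e.symm y) v w) t := by
  have hsurj := (mdifferentiable_of_mem_maximalAtlas he).symm.mfderiv_surjective
    (x := y) (by simpa using hy)
  have key : ∀ v : TangentSpace (𝓡 2) (e.symm y), ∃ a : Fin 2 → ℝ,
      v = ∑ i, a i • mfderiv (𝓡 2) (𝓡 2) e.symm y (EuclideanSpace.single i 1 : Plane) := by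
    intro v
    obtain ⟨v', rfl⟩ := hsurj v
    let L : Plane →L[ℝ] TangentSpace (𝓡 2) (e.symm y) := mfderiv (𝓡 2) (𝓡 2) e.symm y
    let v₀ : Plane := v'
    have h1 : v₀ = ∑ i, v₀ i • (EuclideanSpace.single i 1 : Plane) := by
      ext i
      fin_cases i <;> simp
    refine ⟨fun i => v₀ i, (congrArg L h1).trans ?_⟩
    rw [map_sum]
    exact Finset.sum_congr rfl fun i _ => map_smul _ _ _
  obtain ⟨a, rfl⟩ := key v
  obtain ⟨b, rfl⟩ := key w
  have hb : ∀ s, (g s).inner (e.symm y)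
      (∑ i, a i • mfderiv (𝓡 2) (𝓡 2) e.symm y (EuclideanSpace.single i 1 : Plane))
      (∑ i, b i • mfderiv (𝓡 2) (𝓡 2) e.symm y (EuclideanSpace.single i 1 : Plane)) =
      ∑ i, ∑ j, a i * b j * comp (g s) e.symm y i j := by
    intro s
    simp [comp, Fin.sum_univ_two]
    ring
  simp only [hb]
  refine (HasDerivAt.fun_sum fun i _ => HasDerivAt.fun_sum fun j _ =>
    ((h.isPlaneFlow he).hasDerivAt ht hy i j).const_mul (a i * b j)).congr_deriv ?_
  simp only [Fin.sum_univ_two]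
  ring

/-- For a fixed tangent vector v ≠ 0 the flow gives ∂ₜ g(v,v) = -R g(v,v), which determines R
without reference to a chart. No transformation law for curvature is needed. -/
lemma IsRicciFlow.scalar_eq_of_pos (h : IsRicciFlow g) {e' : OpenPartialHomeomorph M Plane}
    (he : e ∈ IsManifold.maximalAtlas (𝓡 2) ∞ M) (he' : e' ∈ IsManifold.maximalAtlas (𝓡 2) ∞ M)
    {x : M} (hx : x ∈ e.source) (hx' : x ∈ e'.source) {t : ℝ} (ht : 0 < t) :
    scalar (comp (g t) e.symm) (e x) = scalar (comp (g t) e'.symm) (e' x) := by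
  have key : ∀ e ∈ IsManifold.maximalAtlas (𝓡 2) ∞ M, x ∈ e.source →
      ∀ v w : TangentSpace (𝓡 2) x, HasDerivAt (fun s => (g s).inner x v w)
      (-scalar (comp (g t) e.symm) (e x) * (g t).inner x v w) t := by
    intro e he hx
    have h1 := h.hasDerivAt_inner he ht (e.map_source hx)
    rwa [e.left_inv hx] at h1
  let v : TangentSpace (𝓡 2) x := (EuclideanSpace.single 0 1 : Plane)
  have hv : v ≠ 0 := fun h0 => by
    have h1 : (EuclideanSpace.single 0 1 : Plane) = 0 := h0
    simp at h1
  have h1 := (key e he hx v v).unique (key e' he' hx' v v)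
  have h2 := (g t).pos x v hv
  have h3 := mul_right_cancel₀ h2.ne' h1
  linarith

/-- The scalar curvature may be computed in any chart. -/
lemma IsRicciFlow.scalarCurvature_eq (h : IsRicciFlow g)
    (he : e ∈ IsManifold.maximalAtlas (𝓡 2) ∞ M) {x : M} (hx : x ∈ e.source) {t : ℝ}
    (ht : 0 ≤ t) : scalarCurvature (g t) x = scalar (comp (g t) e.symm) (e x) := by
  have hc : ∀ e ∈ IsManifold.maximalAtlas (𝓡 2) ∞ M, x ∈ e.source →
      ContinuousOn (fun s => scalar (comp (g s) e.symm) (e x)) (Set.Ici 0) := by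
    intro e he hx
    exact (h.isPlaneFlow he).continuousOn_scalar.comp (f := fun s : ℝ => (s, e x)) (by fun_prop)
      fun _ hs => ⟨hs, e.map_source hx⟩
  have he' : chartAt Plane x ∈ IsManifold.maximalAtlas (𝓡 2) ∞ M :=
    IsManifold.chart_mem_maximalAtlas x
  -- The flow equation is available only for t > 0; the value at t = 0 follows by continuity of both
  -- sides.
  have h1 : Set.EqOn (fun s => scalarCurvature (g s) x)
      (fun s => scalar (comp (g s) e.symm) (e x)) (Set.Ioi 0) := fun s hs =>
    h.scalar_eq_of_pos he' he (mem_chart_source Plane x) hx hs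
  exact h1.of_subset_closure (hc _ he' (mem_chart_source Plane x)) (hc e he hx)
    Set.Ioi_subset_Ici_self (by simp) ht

lemma IsRicciFlow.continuousOn_scalarCurvature (h : IsRicciFlow g) :
    ContinuousOn (fun p : ℝ × M => scalarCurvature (g p.1) p.2) (Set.Ici 0 ×ˢ Set.univ) := by
  rintro ⟨t, x⟩ ⟨ht, -⟩
  set e := chartAt Plane x
  have he : e ∈ IsManifold.maximalAtlas (𝓡 2) ∞ M := IsManifold.chart_mem_maximalAtlas x
  have hx : x ∈ e.source := mem_chart_source Plane x
  have h1 : ContinuousOn (fun p : ℝ × M => scalar (comp (g p.1) e.symm) (e p.2))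
      (Set.Ici 0 ×ˢ e.source) := by
    refine (h.isPlaneFlow he).continuousOn_scalar.comp (f := fun p : ℝ × M => (p.1, e p.2)) ?_
      fun p hp => ⟨hp.1, e.map_source hp.2⟩
    exact continuousOn_fst.prodMk (e.continuousOn.comp continuousOn_snd fun p hp => hp.2)
  have h2 : ContinuousOn (fun p : ℝ × M => scalarCurvature (g p.1) p.2)
      (Set.Ici 0 ×ˢ e.source) := h1.congr fun p hp => h.scalarCurvature_eq he hp.2 hp.1
  refine (h2 (t, x) ⟨ht, hx⟩).mono_of_mem_nhdsWithin ?_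
  rw [nhdsWithin_prod_eq, nhdsWithin_univ]
  exact Filter.prod_mem_prod self_mem_nhdsWithin (e.open_source.mem_nhds hx)

end Surface

/-! ### The maximum principle with a barrier -/

lemma nonneg_of_hasDerivAt_of_le_left {f : ℝ → ℝ} {f' a t : ℝ} (hf : HasDerivAt f f' t)
    (hat : a < t) (h : ∀ s ∈ Set.Icc a t, f s ≤ f t) : 0 ≤ f' := by
  have h1 := (hasDerivWithinAt_iff_tendsto_slope' (s := Set.Iio t) (by simp)).1
    hf.hasDerivWithinAt
  refine ge_of_tendsto h1 ?_
  filter_upwards [Ioo_mem_nhdsLT hat] with s hs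
  rw [slope_def_field]
  exact div_nonneg_of_nonpos (sub_nonpos.2 (h s ⟨hs.1.le, hs.2.le⟩)) (sub_nonpos.2 hs.2.le)

section Surface

variable {M : Type*} [TopologicalSpace M] [ChartedSpace Plane M] [IsManifold (𝓡 2) ∞ M]

/-- `φ` is a nonnegative proper function whose Laplacian for the metric `g` is at most `B`. -/
structure IsBarrier (g : Metric M) (φ : M → ℝ) (B : ℝ) : Prop where
  continuous : Continuous φ
  nonneg : ∀ x, 0 ≤ φ x
  proper : ∀ c : ℝ, ∃ K : Set M, IsCompact K ∧ ∀ x, x ∉ K → c < φ x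
  bound_nonneg : 0 ≤ B
  laplacian_le : ∀ x, ∃ e ∈ IsManifold.maximalAtlas (𝓡 2) ∞ M, x ∈ e.source ∧
    ContDiffAt ℝ 2 (fun y => φ (e.symm y)) (e x) ∧
    laplacian (comp g e.symm) (fun y => φ (e.symm y)) (e x) ≤ B

/-- The maximum principle: at a positive maximum over `[0, T] × M` of the scalar curvature with
the barrier subtracted, the evolution equation would be violated. -/
lemma IsRicciFlow.not_isMax {g : ℝ → Metric M} (h : IsRicciFlow g) {φ : M → ℝ} {B T A ε t : ℝ}
    (hφ : IsBarrier (g 0) φ B) (hA : 0 ≤ A) (hε : 0 < ε)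
    (hR : ∀ s ∈ Set.Icc 0 T, ∀ x : M, scalarCurvature (g s) x < A) (ht : 0 < t) (htT : t ≤ T)
    (x : M) {F : ℝ → M → ℝ}
    (hF : ∀ s x, F s x = Real.exp (-A * s) * scalarCurvature (g s) x -
      ε * (φ x + (Real.exp (A * T) * B * s + 1)))
    (hpos : 0 < scalarCurvature (g t) x)
    (hmax : ∀ s ∈ Set.Icc 0 T, ∀ z : M, F s z ≤ F t x) : False := by
  obtain ⟨e, he, hx, hφc, hφB⟩ := hφ.laplacian_le x
  have hP := h.isPlaneFlow he
  have hy := e.map_source hx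
  set y := e x
  have hxy : e.symm y = x := e.left_inv hx
  set B' := Real.exp (A * T) * B
  set r : ℝ → Plane → ℝ := fun s => scalar (comp (g s) e.symm) with hr
  have hsc : ∀ s, 0 ≤ s → ∀ z ∈ e.target, scalarCurvature (g s) (e.symm z) = r s z := by
    intro s hs z hz
    rw [h.scalarCurvature_eq he (e.map_target hz) hs, e.right_inv hz]
  have hrc : ContDiffAt ℝ 2 (r t) y := hP.contDiffAt_scalar ht hy
  have hry : scalarCurvature (g t) x = r t y := by rw [← hsc t ht.le y hy, hxy]
  have hlap : laplacian (comp (g t) e.symm) (fun z => φ (e.symm z)) y ≤ B' := by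
    refine hP.laplacian_le (t := t) hy ⟨ht.le, htT⟩ (fun s hs => ?_) hA hφc hφB hφ.bound_nonneg
    have := hR s hs x
    rw [← hxy, hsc s hs.1 y hy] at this
    exact this.le
  have hspace := laplacian_nonpos_of_isLocalMax (isMetricAt_comp (g t) he hy)
    (f := fun z => Real.exp (-A * t) * r t z - ε * (φ (e.symm z) + (B' * t + 1))) (y := y) (by
      filter_upwards [e.open_target.mem_nhds hy] with z hz
      have := hmax t ⟨ht.le, htT⟩ (e.symm z)
      rwa [← hxy, hF, hF, hsc t ht.le z hz, hsc t ht.le y hy] at this)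
    ((contDiffAt_const.mul hrc).sub (contDiffAt_const.mul (hφc.add contDiffAt_const)))
  rw [laplacian_sub hrc hφc] at hspace
  have htime : HasDerivAt
      (fun s => Real.exp (-A * s) * r s y - ε * (φ (e.symm y) + (B' * s + 1)))
      (Real.exp (-A * t) * (laplacian (comp (g t) e.symm) (r t) y + r t y ^ 2 - A * r t y) -
        ε * B') t := by
    refine (((((hasDerivAt_id t).const_mul (-A)).exp).fun_mul
      (hP.hasDerivAt_scalar ht hy)).fun_sub ((((hasDerivAt_id t).const_mul B').add_const
        1).const_add (φ (e.symm y)) |>.const_mul ε)).congr_deriv ?_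
    simp only [id, hr]
    ring
  -- The maximum may occur at the final time T, so only earlier times are compared.
  have htime' := nonneg_of_hasDerivAt_of_le_left htime ht fun s hs => by
    have := hmax s ⟨hs.1, hs.2.trans htT⟩ x
    rwa [← hxy, hF, hF, hsc s hs.1 y hy, hsc t ht.le y hy] at this
  have h1 : 0 < r t y := hry ▸ hpos
  have h2 : r t y < A := hry ▸ hR t ⟨ht.le, htT⟩ x
  have h3 : 0 < Real.exp (-A * t) * (r t y * (A - r t y)) :=
    mul_pos (Real.exp_pos _) (mul_pos h1 (sub_pos.2 h2))
  have h4 := mul_le_mul_of_nonneg_left hlap hε.le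
  -- The space condition gives e^{-At}ΔR ≤ εΔφ ≤ εB'. Inserted in the time condition it leaves 0 ≤
  -- e^{-At}R(R - A), against `h3`.
  nlinarith

lemma IsRicciFlow.scalarCurvature_nonpos {g : ℝ → Metric M} (h : IsRicciFlow g) {φ : M → ℝ}
    {B : ℝ} (hφ : IsBarrier (g 0) φ B) (hbdd : HasBoundedCurvature g)
    (hR₀ : ∀ x : M, scalarCurvature (g 0) x ≤ 0) (T : ℝ) (hT : 0 ≤ T) (x : M) :
    scalarCurvature (g T) x ≤ 0 := by
  by_contra! hx
  obtain ⟨C, hC⟩ := hbdd T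
  have hC0 : 0 ≤ C := (abs_nonneg _).trans (hC T ⟨hT, le_rfl⟩ x)
  set A := C + 1
  set B' := Real.exp (A * T) * B
  have hB' : 0 ≤ B' := mul_nonneg (Real.exp_pos _).le hφ.bound_nonneg
  have hden : 0 < φ x + (B' * T + 1) := by
    have := hφ.nonneg x
    positivity
  -- With this ε the subtracted term at (T, x) is exactly half of e^{-AT}R, so F stays positive
  -- there. The summand 1 keeps the denominator positive even where φ vanishes.
  set ε := Real.exp (-A * T) * scalarCurvature (g T) x / (2 * (φ x + (B' * T + 1))) with hεdef
  have hε : 0 < ε := by positivity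
  set F : ℝ → M → ℝ := fun s x => Real.exp (-A * s) * scalarCurvature (g s) x -
    ε * (φ x + (B' * s + 1)) with hF
  have hFx : 0 < F T x := by
    have : ε * (φ x + (B' * T + 1)) = Real.exp (-A * T) * scalarCurvature (g T) x / 2 := by
      rw [hεdef, ← div_div, div_mul_cancel₀ _ hden.ne']
    have h2 : 0 < Real.exp (-A * T) * scalarCurvature (g T) x := by positivity
    simp only [hF, this]
    linarith
  -- Off K the term εφ exceeds C, hence also e^{-As}R.
  obtain ⟨K, hK, hKφ⟩ := hφ.proper (C / ε)
  have hout : ∀ s ∈ Set.Icc 0 T, ∀ z, z ∉ K → F s z < 0 := by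
    intro s hs z hz
    have h1 := hKφ z hz
    rw [div_lt_iff₀ hε] at h1
    have h2 : Real.exp (-A * s) * scalarCurvature (g s) z ≤ 1 * C := by
      refine (mul_le_mul_of_nonneg_left ((le_abs_self _).trans (hC s hs z))
        (Real.exp_pos _).le).trans (mul_le_mul_of_nonneg_right ?_ hC0)
      rw [Real.exp_le_one_iff]
      have : 0 ≤ A * s := mul_nonneg (by positivity) hs.1
      linarith
    have h3 : 0 ≤ ε * (B' * s + 1) :=
      mul_nonneg hε.le (add_nonneg (mul_nonneg hB' hs.1) zero_le_one)
    simp only [hF]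
    linarith
  have hxK : x ∈ K := by
    by_contra hxK
    exact (hout T ⟨hT, le_rfl⟩ x hxK).not_gt hFx
  have hcont : ContinuousOn (fun p : ℝ × M => F p.1 p.2) (Set.Icc 0 T ×ˢ K) := by
    have h1 : ContinuousOn (fun p : ℝ × M => scalarCurvature (g p.1) p.2) (Set.Icc 0 T ×ˢ K) :=
      h.continuousOn_scalarCurvature.mono
        (Set.prod_mono Set.Icc_subset_Ici_self (Set.subset_univ _))
    have h2 := hφ.continuous
    simp only [hF]
    fun_prop
  obtain ⟨⟨t, z⟩, ⟨ht, hz⟩, hmax⟩ := (isCompact_Icc.prod hK).exists_isMaxOn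
    ⟨(T, x), ⟨hT, le_rfl⟩, hxK⟩ hcont
  have hFz : 0 < F t z := hFx.trans_le (hmax (a := (T, x)) ⟨⟨hT, le_rfl⟩, hxK⟩)
  have hRz : 0 < scalarCurvature (g t) z := by
    have h1 : 0 ≤ ε * (φ z + (B' * t + 1)) := mul_nonneg hε.le
      (add_nonneg (hφ.nonneg z) (add_nonneg (mul_nonneg hB' ht.1) zero_le_one))
    have h2 : 0 < Real.exp (-A * t) * scalarCurvature (g t) z := by
      simp only [hF] at hFz
      linarith
    exact pos_of_mul_pos_right h2 (Real.exp_pos _).le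
  have ht0 : 0 < t := by
    refine lt_of_le_of_ne ht.1 fun h0 => ?_
    rw [← h0] at hRz
    exact (hR₀ z).not_gt hRz
  refine h.not_isMax hφ (A := A) (T := T) (by positivity) hε (fun s hs w => ?_) ht0 ht.2 z
    (F := F) (fun _ _ => rfl) hRz fun s hs w => ?_
  · have := (le_abs_self _).trans (hC s hs w)
    linarith
  · by_cases hw : w ∈ K
    · exact hmax (a := (s, w)) ⟨hs, hw⟩
    · exact ((hout s hs w hw).trans hFz).le

end Surface

/-! ### The Laplacian of the radial function on a cone -/

lemma pd_coord (i j : Fin 2) (y : Plane) : pd i (fun z => z j) y = if i = j then 1 else 0 := by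
  have h : fderiv ℝ (fun z : Plane => z j) y = EuclideanSpace.proj j :=
    (EuclideanSpace.proj (𝕜 := ℝ) j : Plane →L[ℝ] ℝ).fderiv
  simp [pd, h, eq_comm]

lemma differentiableAt_coord (j : Fin 2) (y : Plane) :
    DifferentiableAt ℝ (fun z : Plane => z j) y :=
  (EuclideanSpace.proj (𝕜 := ℝ) j : Plane →L[ℝ] ℝ).differentiableAt

lemma eventually_coord_lt {c : ℝ} {y : Plane} (h : c < y 0) : ∀ᶠ z : Plane in 𝓝 y, c < z 0 :=
  (differentiableAt_coord 0 y).continuousAt.eventually (lt_mem_nhds h)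

/-- A smoothing of max(s, 0): linear growth makes the barrier proper, and vanishing for s ≤ 0 allows
extension by zero into the core. -/
lemma exists_cutoff : ∃ (χ : ℝ → ℝ) (C : ℝ), ContDiff ℝ 2 χ ∧ (∀ s ≤ 0, χ s = 0) ∧
    (∀ s, 1 ≤ s → χ s = s) ∧ (∀ s, 0 ≤ χ s) ∧ 0 ≤ C ∧ ∀ s, |deriv χ s| ≤ C ∧
      |deriv (deriv χ) s| ≤ C := by
  set χ : ℝ → ℝ := fun s => Real.smoothTransition s * s with hχ
  have hc : ContDiff ℝ 2 χ := Real.smoothTransition.contDiff.mul contDiff_id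
  have h0 : ∀ s ≤ 0, χ s = 0 := fun s hs => by
    simp [hχ, Real.smoothTransition.zero_of_nonpos hs]
  have h1 : ∀ s, 1 ≤ s → χ s = s := fun s hs => by
    simp [hχ, Real.smoothTransition.one_of_one_le hs]
  have hc1 : ContDiff ℝ 1 (deriv χ) := hc.deriv' (n := 1)
  have hd1 : Continuous (deriv χ) := hc1.continuous
  have hd2 : Continuous (deriv (deriv χ)) := hc1.continuous_deriv le_rfl
  obtain ⟨C₁, hC₁⟩ := isCompact_Icc.exists_bound_of_continuousOn (hd1.continuousOn (s := Set.Icc 0 1))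
  obtain ⟨C₂, hC₂⟩ := isCompact_Icc.exists_bound_of_continuousOn (hd2.continuousOn (s := Set.Icc 0 1))
  -- The 1 accounts for the slope of χ beyond s = 1.
  refine ⟨χ, max (max C₁ C₂) 1, hc, h0, h1, fun s => ?_, by positivity, fun s => ?_⟩
  · rcases le_total s 0 with hs | hs
    · rw [h0 s hs]
    · exact mul_nonneg (Real.smoothTransition.nonneg s) hs
  · rcases lt_or_ge s 0 with hs | hs
    · have e : χ =ᶠ[𝓝 s] fun _ => 0 := by
        filter_upwards [gt_mem_nhds hs] with z hz using h0 z hz.le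
      rw [e.deriv.deriv_eq, e.deriv_eq]
      simp
    rcases lt_or_ge 1 s with hs' | hs'
    · have e : χ =ᶠ[𝓝 s] fun z => z := by
        filter_upwards [lt_mem_nhds hs'] with z hz using h1 z hz.le
      rw [e.deriv.deriv_eq, e.deriv_eq]
      simp
    · have b1 := hC₁ s ⟨hs, hs'⟩
      have b2 := hC₂ s ⟨hs, hs'⟩
      rw [Real.norm_eq_abs] at b1 b2
      exact ⟨b1.trans ((le_max_left _ _).trans (le_max_left _ _)),
        b2.trans ((le_max_right _ _).trans (le_max_left _ _))⟩

/-- Removes the weight r^τ. The θ-derivative may grow like r, because it is r⁻¹∂_θ that belongs to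
the frame. -/
lemma MemHolder.bounds {β ρ τ : ℝ} {q : Plane → ℝ} (hτ : 0 < τ)
    (h : MemHolder β ρ (fun y => y 0 ^ τ * q y)) :
    ∃ C, 0 ≤ C ∧ ∀ y : Plane, ρ ≤ y 0 → 1 ≤ y 0 → DifferentiableAt ℝ q y ∧
      |q y| ≤ C * y 0 ^ (-τ) ∧ |pd 0 q y| ≤ C ∧ |pd 1 q y| ≤ C * y 0 := by
  obtain ⟨hc, C, hC, -⟩ := h
  -- With k the weighted function, ∂_r(r^{-τ}k) = r^{-τ}∂_r k - τ r^{-τ-1}k; for r ≥ 1 the two terms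
  -- contribute |C| and τ|C|.
  refine ⟨(τ + 1) * |C|, by positivity, fun y hy h1 => ?_⟩
  have hr : 0 < y 0 := by linarith
  set k : Plane → ℝ := fun y => y 0 ^ τ * q y with hk
  have hkd : DifferentiableAt ℝ k y := (hc y hy).differentiableAt (by norm_num)
  obtain ⟨b0, b1, -⟩ := hC y hy
  have hq : q =ᶠ[𝓝 y] fun z => z 0 ^ (-τ) * k z := by
    filter_upwards [eventually_coord_lt hr] with z hz
    rw [hk]
    simp only
    rw [← mul_assoc, ← Real.rpow_add hz]
    simp
  have hp : HasDerivAt (fun r : ℝ => r ^ (-τ)) (-τ * y 0 ^ (-τ - 1)) (y 0) :=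
    Real.hasDerivAt_rpow_const (Or.inl hr.ne')
  have hpd : DifferentiableAt ℝ (fun z : Plane => z 0 ^ (-τ)) y :=
    (differentiableAt_coord 0 y).rpow_const (Or.inl hr.ne')
  have hle : C ≤ |C| := le_abs_self C
  have hp1 : y 0 ^ (-τ) ≤ 1 := Real.rpow_le_one_of_one_le_of_nonpos h1 (by linarith)
  have hp2 : y 0 ^ (-τ - 1) ≤ 1 := Real.rpow_le_one_of_one_le_of_nonpos h1 (by linarith)
  have hp1' : 0 < y 0 ^ (-τ) := Real.rpow_pos_of_pos hr _
  have hp2' : 0 < y 0 ^ (-τ - 1) := Real.rpow_pos_of_pos hr _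
  have b10 := b1 0
  have b11 := b1 1
  simp only [coneDeriv, if_true, one_ne_zero, if_false, abs_mul, abs_inv, abs_of_pos hr] at b10 b11
  rw [inv_mul_le_iff₀ hr] at b11
  have hC1 : |C| ≤ (τ + 1) * |C| := le_mul_of_one_le_left (abs_nonneg _) (by linarith)
  refine ⟨(hpd.mul hkd).congr_of_eventuallyEq hq, ?_, ?_, ?_⟩
  · rw [hq.self_of_nhds, abs_mul, abs_of_pos hp1', mul_comm]
    exact mul_le_mul_of_nonneg_right ((b0.trans hle).trans hC1) hp1'.le
  · rw [pd_congr hq, pd_mul hpd hkd, pd_comp hp (differentiableAt_coord 0 y), pd_coord]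
    simp only [if_true, mul_one]
    have t1 : |y 0 ^ (-τ) * pd 0 k y| ≤ |C| := by
      rw [abs_mul, abs_of_pos hp1']
      exact (mul_le_of_le_one_left (abs_nonneg _) hp1).trans (b10.trans hle)
    have t2 : |-τ * y 0 ^ (-τ - 1) * k y| ≤ τ * |C| := by
      rw [abs_mul, abs_mul, abs_neg, abs_of_pos hτ, abs_of_pos hp2', mul_assoc]
      exact mul_le_mul_of_nonneg_left
        ((mul_le_of_le_one_left (abs_nonneg _) hp2).trans (b0.trans hle)) hτ.le
    calc _ ≤ _ := abs_add_le _ _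
      _ ≤ |C| + τ * |C| := add_le_add t1 t2
      _ = _ := by ring
  · rw [pd_congr hq, pd_mul hpd hkd, pd_comp hp (differentiableAt_coord 0 y), pd_coord]
    simp only [one_ne_zero, if_false, mul_zero, zero_mul, add_zero]
    rw [abs_mul, abs_of_pos hp1']
    refine (mul_le_of_le_one_left (abs_nonneg _) hp1).trans (b11.trans ?_)
    rw [mul_comm]
    exact mul_le_mul_of_nonneg_right (hle.trans hC1) hr.le

/-- The left side is the Laplacian of χ(r - c) after all powers of r have cancelled, with p = χ''
and q = χ'. Here e, f, d are the components of the metric in the frame ∂_r, r⁻¹∂_θ and the aᵢ are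
rescaled first derivatives of its coordinate components. The three groups multiplying q contribute
4Q³ each, and 12Q³ / (2w₀²) is the second constant. -/
lemma radial_bound {e f d a₁ a₂ a₃ a₄ a₅ a₆ Q w₀ p q C : ℝ} (he : |e| ≤ Q) (hf : |f| ≤ Q)
    (hd : |d| ≤ Q) (h₁ : |a₁| ≤ Q) (h₂ : |a₂| ≤ Q) (h₃ : |a₃| ≤ Q) (h₄ : |a₄| ≤ Q)
    (h₅ : |a₅| ≤ Q) (h₆ : |a₆| ≤ Q) (hw₀ : 0 < w₀) (hw : w₀ ≤ e * d - f ^ 2) (hp : |p| ≤ C)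
    (hq : |q| ≤ C) :
    d * p / (e * d - f ^ 2) - q * (d * (d * a₁ - f * (2 * a₃ - a₂)) -
      2 * (f * (d * a₂ - f * a₅)) + e * (d * (2 * a₄ - a₅) - f * a₆)) /
        (2 * (e * d - f ^ 2) ^ 2) ≤ (Q / w₀ + 6 * Q ^ 3 / w₀ ^ 2) * C := by
  have hQ : 0 ≤ Q := (abs_nonneg _).trans he
  have hC : 0 ≤ C := (abs_nonneg _).trans hp
  set w := e * d - f ^ 2
  have hwpos : 0 < w := hw₀.trans_le hw
  have m2 : ∀ {a b A B : ℝ}, |a| ≤ A → |b| ≤ B → |a * b| ≤ A * B := fun {a b A B} ha hb => by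
    rw [abs_mul]; exact mul_le_mul ha hb (abs_nonneg _) ((abs_nonneg _).trans ha)
  have s2 : ∀ {a b A B : ℝ}, |a| ≤ A → |b| ≤ B → |a - b| ≤ A + B := fun ha hb =>
    (abs_sub _ _).trans (add_le_add ha hb)
  have p2 : ∀ {a b A B : ℝ}, |a| ≤ A → |b| ≤ B → |a + b| ≤ A + B := fun ha hb =>
    (abs_add_le _ _).trans (add_le_add ha hb)
  have c2 : |(2 : ℝ)| ≤ 2 := by norm_num
  have hN := p2 (s2 (m2 hd (s2 (m2 hd h₁) (m2 hf (s2 (m2 c2 h₃) h₂))))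
    (m2 c2 (m2 hf (s2 (m2 hd h₂) (m2 hf h₅)))))
    (m2 he (s2 (m2 hd (s2 (m2 c2 h₄) h₅)) (m2 hf h₆)))
  have t1 : d * p / w ≤ Q * C / w₀ :=
    div_le_div₀ (mul_nonneg hQ hC) ((le_abs_self _).trans (m2 hd hp)) hw₀ hw
  have hqN := m2 hq hN
  have hqN' := (neg_le_abs _).trans hqN
  have t2 := div_le_div₀ ((abs_nonneg _).trans hqN) hqN' (by positivity : 0 < 2 * w₀ ^ 2)
    (by gcongr : 2 * w₀ ^ 2 ≤ 2 * w ^ 2)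
  rw [sub_eq_add_neg, ← neg_div]
  refine (add_le_add t1 t2).trans (le_of_eq ?_)
  field_simp
  ring

/-- On a metric asymptotic to a cone, functions of the radius have bounded Laplacian. -/
lemma exists_laplacian_radial_le {G : Plane → Matrix (Fin 2) (Fin 2) ℝ} {α β ρ τ : ℝ}
    (hα : 0 < α) (hτ : 0 < τ)
    (hG : ∀ i j : Fin 2, MemHolder β ρ (fun y => y 0 ^ τ * coneError α G i j y)) :
    ∃ ρ' B : ℝ, ρ < ρ' ∧ 0 ≤ B ∧ ∀ y : Plane, ρ' ≤ y 0 → IsMetricAt G y →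
      ∀ (χ : ℝ → ℝ) (c C : ℝ), ContDiff ℝ 2 χ →
        (∀ s, |deriv χ s| ≤ C ∧ |deriv (deriv χ) s| ≤ C) →
          laplacian G (fun z => χ (z 0 - c)) y ≤ B * C := by
  choose K hK0 hK using fun i j => (hG i j).bounds hτ
  set L := ∑ i, ∑ j, K i j with hL
  have hL0 : 0 ≤ L := Finset.sum_nonneg fun i _ => Finset.sum_nonneg fun j _ => hK0 i j
  have hKL : ∀ i j, K i j ≤ L := fun i j =>
    (Finset.single_le_sum (f := fun j => K i j) (fun j _ => hK0 i j) (Finset.mem_univ j)).trans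
      (Finset.single_le_sum (f := fun i => ∑ j, K i j)
        (fun i _ => Finset.sum_nonneg fun j _ => hK0 i j) (Finset.mem_univ i))
  -- Errors below δ keep the frame determinant above (1/2)(3α²/4) - (1/2)(α²/4) = α²/4, more than
  -- the w₀ used below.
  set δ := min (1 / 2) (α ^ 2 / 4) with hδ
  have hδ0 : 0 < δ := by positivity
  have hδ1 : δ ≤ 1 / 2 := min_le_left _ _
  have hδ2 : δ ≤ α ^ 2 / 4 := min_le_right _ _
  have hlim : Filter.Tendsto (fun r : ℝ => L * r ^ (-τ)) Filter.atTop (𝓝 0) := by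
    simpa using (tendsto_rpow_neg_atTop hτ).const_mul L
  obtain ⟨r₀, hr₀⟩ := Filter.eventually_atTop.1 (hlim.eventually (gt_mem_nhds hδ0))
  set Q := 2 + 3 * α ^ 2 + 3 * L with hQ
  set w₀ := α ^ 2 / 8 with hw₀
  -- Radius and constant are fixed before χ and c, because the barrier takes c to be this very
  -- radius.
  refine ⟨max (max r₀ 1) (ρ + 1), Q / w₀ + 6 * Q ^ 3 / w₀ ^ 2,
    (lt_add_one ρ).trans_le (le_max_right _ _), by positivity, fun y hy hm χ c C hχ hχC => ?_⟩
  have hy1 : 1 ≤ y 0 := (le_max_right _ _).trans ((le_max_left _ _).trans hy)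
  have hyr : r₀ ≤ y 0 := (le_max_left _ _).trans ((le_max_left _ _).trans hy)
  have hyρ : ρ ≤ y 0 := (lt_add_one ρ).le.trans ((le_max_right _ _).trans hy)
  set r := y 0 with hr
  have hrpos : 0 < r := by linarith
  set q : Fin 2 → Fin 2 → Plane → ℝ := coneError α G with hq
  have hqd : ∀ i j, DifferentiableAt ℝ (q i j) y := fun i j => (hK i j y hyρ hy1).1
  have hqs : ∀ i j, |q i j y| ≤ δ := fun i j =>
    ((hK i j y hyρ hy1).2.1.trans (mul_le_mul_of_nonneg_right (hKL i j)
      (Real.rpow_nonneg hrpos.le _))).trans (hr₀ r hyr).le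
  have hq0 : ∀ i j, |pd 0 (q i j) y| ≤ L := fun i j => (hK i j y hyρ hy1).2.2.1.trans (hKL i j)
  have hq1 : ∀ i j, |pd 1 (q i j) y / r| ≤ L := fun i j => by
    rw [abs_div, abs_of_pos hrpos, div_le_iff₀ hrpos]
    exact (hK i j y hyρ hy1).2.2.2.trans (mul_le_mul_of_nonneg_right (hKL i j) hrpos.le)
  have hE : (fun z => G z 0 0) =ᶠ[𝓝 y] fun z => 1 + q 0 0 z := by
    filter_upwards [eventually_coord_lt hrpos] with z hz
    simp [hq, coneError]
  have hF : (fun z => G z 0 1) =ᶠ[𝓝 y] fun z => z 0 * q 0 1 z := by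
    filter_upwards [eventually_coord_lt hrpos] with z hz
    have := hz.ne'
    simp [hq, coneError]
    field_simp
  have hD : (fun z => G z 1 1) =ᶠ[𝓝 y] fun z => (z 0 * z 0) * (α ^ 2 + q 1 1 z) := by
    filter_upwards [eventually_coord_lt hrpos] with z hz
    have := hz.ne'
    simp [hq, coneError]
    field_simp
    ring
  have hc0 := differentiableAt_coord 0 y
  have dE : ∀ i, pd i (fun z => G z 0 0) y = pd i (q 0 0) y := fun i => by
    rw [pd_congr hE, pd_add (by fun_prop) (hqd 0 0), pd_const, zero_add]
  have dF : ∀ i, pd i (fun z => G z 0 1) y =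
      r * pd i (q 0 1) y + (if i = 0 then 1 else 0) * q 0 1 y := fun i => by
    rw [pd_congr hF, pd_mul hc0 (hqd 0 1), pd_coord]
  have dD : ∀ i, pd i (fun z => G z 1 1) y = r * r * pd i (q 1 1) y +
      (r * (if i = 0 then 1 else 0) + (if i = 0 then 1 else 0) * r) * (α ^ 2 + q 1 1 y) :=
    fun i => by
      rw [pd_congr hD, pd_mul (hc0.fun_mul hc0) ((hqd 1 1).const_add _), pd_mul hc0 hc0, pd_coord,
        pd_add (by fun_prop) (hqd 1 1), pd_const, zero_add]
  have vE : G y 0 0 = 1 + q 0 0 y := hE.self_of_nhds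
  have vF : G y 0 1 = r * q 0 1 y := hF.self_of_nhds
  have vD : G y 1 1 = r * r * (α ^ 2 + q 1 1 y) := hD.self_of_nhds
  have hsub : ∀ z, DifferentiableAt ℝ (fun z : Plane => z 0 - c) z := fun z =>
    (differentiableAt_coord 0 z).sub_const c
  have hsub' : ∀ i z, pd i (fun z : Plane => z 0 - c) z = if i = 0 then 1 else 0 := fun i z => by
    rw [pd_sub (differentiableAt_coord 0 z) (by fun_prop), pd_coord, pd_const, sub_zero]
  have hχ1 : ContDiff ℝ 1 (deriv χ) := hχ.deriv' (n := 1)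
  have d1 : ∀ i, pd i (fun z => χ (z 0 - c)) =
      fun z => deriv χ (z 0 - c) * if i = 0 then 1 else 0 := fun i => by
    funext z
    rw [pd_comp (hχ.differentiable (by norm_num) _).hasDerivAt (hsub z), hsub']
  have d1' : ∀ i, pd i (fun z => χ (z 0 - c)) y = deriv χ (r - c) * if i = 0 then 1 else 0 :=
    fun i => congrFun (d1 i) y
  have d2 : ∀ i j, pd i (pd j (fun z => χ (z 0 - c))) y =
      (deriv (deriv χ) (r - c) * if i = 0 then 1 else 0) * if j = 0 then 1 else 0 := fun i j => by
    have hd : DifferentiableAt ℝ (fun z : Plane => deriv χ (z 0 - c)) y :=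
      (hχ1.differentiable (by norm_num) _).comp y (hsub y)
    rw [d1, pd_mul hd (by fun_prop), pd_const,
      pd_comp (hχ1.differentiable (by norm_num) _).hasDerivAt (hsub y), hsub']
    ring
  have hfc : ContDiffAt ℝ 2 (fun z : Plane => χ (z 0 - c)) y := by
    have : ContDiff ℝ 2 (fun z : Plane => z 0 - c) :=
      (EuclideanSpace.proj (𝕜 := ℝ) (0 : Fin 2) : Plane →L[ℝ] ℝ).contDiff.sub contDiff_const
    exact (hχ.comp this).contDiffAt
  obtain ⟨-, c000, c001, c011, -⟩ := hm.christoffel_eq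
  have hα2 : 0 < α ^ 2 := by positivity
  obtain ⟨l00, u00⟩ := abs_le.1 (hqs 0 0)
  obtain ⟨l01, u01⟩ := abs_le.1 (hqs 0 1)
  obtain ⟨l11, u11⟩ := abs_le.1 (hqs 1 1)
  have hw : w₀ ≤ (1 + q 0 0 y) * (α ^ 2 + q 1 1 y) - q 0 1 y ^ 2 := by
    have h1 : 1 / 2 * (3 * α ^ 2 / 4) ≤ (1 + q 0 0 y) * (α ^ 2 + q 1 1 y) :=
      mul_le_mul (by linarith) (by linarith) (by positivity) (by linarith)
    have h2 : q 0 1 y ^ 2 ≤ 1 / 2 * (α ^ 2 / 4) := by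
      rw [← sq_abs, pow_two]
      exact mul_le_mul ((hqs 0 1).trans hδ1) ((hqs 0 1).trans hδ2) (abs_nonneg _) (by norm_num)
    linarith
  -- For G₀₀, G₀₁, G₁₁ the r-derivatives are divided by 1, r, r² and the θ-derivatives by r, r², r³.
  have key := radial_bound (e := 1 + q 0 0 y) (f := q 0 1 y) (d := α ^ 2 + q 1 1 y)
    (a₁ := pd 0 (q 0 0) y) (a₂ := pd 1 (q 0 0) y / r) (a₃ := q 0 1 y / r + pd 0 (q 0 1) y)
    (a₄ := pd 1 (q 0 1) y / r) (a₅ := 2 * (α ^ 2 + q 1 1 y) / r + pd 0 (q 1 1) y)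
    (a₆ := pd 1 (q 1 1) y / r) (Q := Q) (w₀ := w₀) (p := deriv (deriv χ) (r - c))
    (q := deriv χ (r - c)) (C := C) ?_ ?_ ?_ ?_ ?_ ?_ ?_ ?_ ?_ (by positivity) hw (hχC _).2 (hχC _).1
  · refine le_of_eq_of_le ?_ key
    have hw' : (1 + q 0 0 y) * (α ^ 2 + q 1 1 y) - q 0 1 y ^ 2 ≠ 0 :=
      ((by positivity : 0 < w₀).trans_le hw).ne'
    have hdet : (1 + q 0 0 y) * (r * r * (α ^ 2 + q 1 1 y)) - (r * q 0 1 y) ^ 2 =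
        r ^ 2 * ((1 + q 0 0 y) * (α ^ 2 + q 1 1 y) - q 0 1 y ^ 2) := by ring
    rw [hm.laplacian_eq hfc, c000, c001, c011]
    simp only [d1', d2, dE, dF, dD, vE, vF, vD, hdet]
    generalize (1 + q 0 0 y) * (α ^ 2 + q 1 1 y) - q 0 1 y ^ 2 = w at *
    simp
    field_simp
    ring
  · exact abs_le.2 ⟨by linarith, by linarith⟩
  · exact abs_le.2 ⟨by linarith, by linarith⟩
  · exact abs_le.2 ⟨by linarith, by linarith⟩
  · exact (hq0 0 0).trans (by linarith)
  · exact (hq1 0 0).trans (by linarith)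
  · refine (abs_add_le _ _).trans ((add_le_add ?_ (hq0 0 1)).trans
      (by linarith : δ + L ≤ Q))
    rw [abs_div, abs_of_pos hrpos]
    exact (div_le_self (abs_nonneg _) hy1).trans (hqs 0 1)
  · exact (hq1 0 1).trans (by linarith)
  · refine (abs_add_le _ _).trans ((add_le_add ?_ (hq0 1 1)).trans
      (by linarith : 2 * (α ^ 2 + δ) + L ≤ Q))
    rw [abs_div, abs_of_pos hrpos]
    refine (div_le_self (abs_nonneg _) hy1).trans (abs_le.2 ⟨by linarith, by linarith⟩)
  · exact (hq1 1 1).trans (by linarith)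

/-! ### The barrier function of an asymptotically conical metric -/

lemma christoffel_congr {G G' : Plane → Matrix (Fin 2) (Fin 2) ℝ} {y : Plane} (h : G =ᶠ[𝓝 y] G')
    (k i j : Fin 2) : christoffel G k i j y = christoffel G' k i j y := by
  have h' : ∀ i j : Fin 2, (fun z => G z i j) =ᶠ[𝓝 y] fun z => G' z i j := fun i j =>
    h.mono fun z hz => by simp only [hz]
  simp only [christoffel, h.self_of_nhds, fun i j k => pd_congr (h' i j) k]

lemma laplacian_congr_metric {G G' : Plane → Matrix (Fin 2) (Fin 2) ℝ} {y : Plane}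
    (h : G =ᶠ[𝓝 y] G') (f : Plane → ℝ) : laplacian G f y = laplacian G' f y := by
  simp only [laplacian, h.self_of_nhds, christoffel_congr h]

lemma IsMetricAt.congr {G G' : Plane → Matrix (Fin 2) (Fin 2) ℝ} {y : Plane}
    (hG : IsMetricAt G y) (h : G' =ᶠ[𝓝 y] G) : IsMetricAt G' y where
  contDiffAt i j := (hG.contDiffAt i j).congr_of_eventuallyEq
    (h.mono fun z hz => by simp only [hz])
  symm := by filter_upwards [h, hG.symm] with z h1 h2 using by rw [h1, h2]
  pos := by rw [h.self_of_nhds]; exact hG.pos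
  det_pos := by rw [h.self_of_nhds]; exact hG.det_pos

section Surface

variable {M : Type*} [TopologicalSpace M] [ChartedSpace Plane M] [IsManifold (𝓡 2) ∞ M]

/-- Polar coordinates are periodic in θ, hence not a chart; their local inverses belong to the
maximal atlas, so computations in (r, θ) are computations in charts. -/
lemma exists_chart_of_isLocalDiffeomorphAt {Φ : Plane → M} {y : Plane}
    (h : IsLocalDiffeomorphAt (𝓡 2) (𝓡 2) ∞ Φ y) :
    ∃ e ∈ IsManifold.maximalAtlas (𝓡 2) ∞ M, Φ y ∈ e.source ∧ e (Φ y) = y ∧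
      ∀ᶠ z in 𝓝 y, e.symm z = Φ z := by
  obtain ⟨Ψ, hy, hΨ⟩ := h
  refine ⟨Ψ.symm.toOpenPartialHomeomorph,
    OpenPartialHomeomorph.mem_maximalAtlas_of_contMDiffOn _ Ψ.contMDiffOn_invFun
      Ψ.contMDiffOn_toFun, ?_, ?_, ?_⟩
  · rw [hΨ hy]
    exact Ψ.map_source hy
  · rw [hΨ hy]
    exact Ψ.left_inv hy
  · filter_upwards [Ψ.open_source.mem_nhds hy] with z hz using (hΨ hz).symm

lemma comp_eventuallyEq (g : Metric M) {Φ Ψ : Plane → M} {y : Plane} (h : Φ =ᶠ[𝓝 y] Ψ) :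
    comp g Φ =ᶠ[𝓝 y] comp g Ψ := by
  filter_upwards [h.eventuallyEq_nhds] with z hz
  ext i j
  have key : ∀ p q : M, p = q → ∀ v w : Plane, g.inner p v w = g.inner q v w := by
    rintro p q rfl v w
    rfl
  simp only [comp, Matrix.of_apply]
  rw [Filter.EventuallyEq.mfderiv_eq hz]
  exact key _ _ hz.self_of_nhds _ _

omit [IsManifold (𝓡 2) ∞ M] in
/-- A function of the radius on each end, extended by zero. -/
lemma Ends.exists_radial (E : Ends M) (χ : Fin E.num → ℝ → ℝ) :
    ∃ φ : M → ℝ, (∀ a (y : Plane), E.innerRadius a < y 0 → φ (E.polar a y) = χ a (y 0)) ∧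
      ∀ x, (∀ a (y : Plane), E.innerRadius a < y 0 → E.polar a y ≠ x) → φ x = 0 := by
  classical
  -- The value does not depend on the chosen preimage: the ends are disjoint, and on one end a point
  -- determines r.
  refine ⟨fun x => if h : ∃ p : Fin E.num × Plane, E.innerRadius p.1 < p.2 0 ∧
    E.polar p.1 p.2 = x then χ h.choose.1 (h.choose.2 0) else 0, fun a y hy => ?_, fun x hx => ?_⟩
  · have h : ∃ p : Fin E.num × Plane, E.innerRadius p.1 < p.2 0 ∧
        E.polar p.1 p.2 = E.polar a y := ⟨(a, y), hy, rfl⟩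
    simp only [dif_pos h]
    obtain ⟨h1, h2⟩ := h.choose_spec
    have ha : h.choose.1 = a := by
      by_contra hne
      exact Set.disjoint_left.1 (E.disjoint _ _ hne) ⟨_, h1, h2⟩ ⟨y, hy, rfl⟩
    generalize h.choose = p at h1 h2 ha
    obtain ⟨b, z⟩ := p
    obtain rfl : b = a := ha
    rw [((E.polar_eq_iff b z y h1 hy).1 h2).1]
  · refine dif_neg ?_
    rintro ⟨p, h1, h2⟩
    exact hx p.1 p.2 h1 h2

theorem IsAsymptoticallyConical.exists_isBarrier {τ : ℝ} {g : Metric M}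
    (h : IsAsymptoticallyConical τ g) : ∃ (φ : M → ℝ) (B : ℝ), IsBarrier g φ B := by
  obtain ⟨hτ, β, -, -, E, hE⟩ := h
  choose α ρ hα hρ hG using hE
  choose ρ' B hρ' hB hlap using fun a => exists_laplacian_radial_le (hα a) hτ (hG a)
  obtain ⟨χ, C, hχ, hχ0, hχ1, hχpos, hC, hχC⟩ := exists_cutoff
  obtain ⟨φ, hφ, hφ0⟩ := E.exists_radial fun a r => χ (r - ρ' a)
  have hin : ∀ a, E.innerRadius a < ρ' a := fun a => (hρ a).trans (hρ' a)
  have hout : ∀ x, (∀ a (y : Plane), ρ' a ≤ y 0 → E.polar a y ≠ x) →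
      φ =ᶠ[𝓝 x] fun _ => 0 := by
    intro x hx
    -- Closedness of the regions r ≥ ρ' in M is what makes the extension by zero continuous and
    -- smooth off the ends.
    have hcl : IsClosed (⋃ a, E.polar a '' {y | ρ' a ≤ y 0}) :=
      isClosed_iUnion_of_finite fun a => E.isClosed_image a (ρ' a) (hin a)
    have hmem : (⋃ a, E.polar a '' {y | ρ' a ≤ y 0})ᶜ ∈ 𝓝 x := by
      refine hcl.isOpen_compl.mem_nhds fun hx' => ?_
      obtain ⟨a, y, hy, rfl⟩ := Set.mem_iUnion.1 hx'
      exact hx a y hy rfl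
    filter_upwards [hmem] with z hz
    by_cases hz' : ∀ a (y : Plane), E.innerRadius a < y 0 → E.polar a y ≠ z
    · exact hφ0 z hz'
    push Not at hz'
    obtain ⟨a, y, hy, rfl⟩ := hz'
    rw [hφ a y hy]
    refine hχ0 _ (sub_nonpos.2 (le_of_not_ge fun hle => hz ?_))
    exact Set.mem_iUnion.2 ⟨a, y, hle, rfl⟩
  have hchart : ∀ a (y : Plane), ρ' a ≤ y 0 → ∃ e ∈ IsManifold.maximalAtlas (𝓡 2) ∞ M,
      E.polar a y ∈ e.source ∧ e (E.polar a y) = y ∧ (∀ᶠ z in 𝓝 y, e.symm z = E.polar a z) ∧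
      (fun z => φ (e.symm z)) =ᶠ[𝓝 y] fun z => χ (z 0 - ρ' a) := by
    intro a y hy
    have hy' := (hin a).trans_le hy
    obtain ⟨e, he, h1, h2, h3⟩ := exists_chart_of_isLocalDiffeomorphAt (E.localDiffeo a ⟨y, hy'⟩)
    refine ⟨e, he, h1, h2, h3, ?_⟩
    filter_upwards [h3, eventually_coord_lt hy'] with z hz1 hz2
    rw [hz1, hφ a z hz2]
  have hsm : ∀ a, ContDiff ℝ 2 (fun z : Plane => χ (z 0 - ρ' a)) := fun a =>
    hχ.comp ((EuclideanSpace.proj (𝕜 := ℝ) (0 : Fin 2) : Plane →L[ℝ] ℝ).contDiff.sub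
      contDiff_const)
  have hBC : 0 ≤ (∑ a, B a) * C := mul_nonneg (Finset.sum_nonneg fun a _ => hB a) hC
  refine ⟨φ, (∑ a, B a) * C, ?_, ?_, ?_, hBC, ?_⟩
  · rw [continuous_iff_continuousAt]
    intro x
    by_cases hx : ∀ a (y : Plane), ρ' a ≤ y 0 → E.polar a y ≠ x
    · exact continuousAt_const.congr (hout x hx).symm
    push Not at hx
    obtain ⟨a, y, hy, rfl⟩ := hx
    obtain ⟨e, -, h1, h2, -, h4⟩ := hchart a y hy
    have hc : ContinuousAt (fun z => φ (e.symm z)) (e (E.polar a y)) := by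
      rw [h2]
      exact (hsm a).continuous.continuousAt.congr h4.symm
    refine (ContinuousAt.comp hc (e.continuousAt h1)).congr ?_
    filter_upwards [e.open_source.mem_nhds h1] with z hz
    simp [e.left_inv hz]
  · intro x
    by_cases hx : ∀ a (y : Plane), E.innerRadius a < y 0 → E.polar a y ≠ x
    · rw [hφ0 x hx]
    push Not at hx
    obtain ⟨a, y, hy, rfl⟩ := hx
    rw [hφ a y hy]
    exact hχpos _
  · intro c
    -- Beyond this radius r - ρ' > |c| + 1 ≥ 1, so χ is the identity there and φ > c.
    refine ⟨_, E.isCompact_core (fun a => ρ' a + (|c| + 1)) fun a => ?_, fun x hx => ?_⟩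
    · linarith [hin a, abs_nonneg c]
    · rw [Set.mem_compl_iff, not_not] at hx
      obtain ⟨a, y, hy, rfl⟩ := Set.mem_iUnion.1 hx
      have hy' : ρ' a + (|c| + 1) < y 0 := hy
      have hc := abs_nonneg c
      rw [hφ a y (by linarith [hin a]), hχ1 _ (by linarith)]
      linarith [le_abs_self c]
  · intro x
    by_cases hx : ∀ a (y : Plane), ρ' a ≤ y 0 → E.polar a y ≠ x
    · set e := chartAt Plane x
      have hxe : x ∈ e.source := mem_chart_source Plane x
      have h0 : (fun y => φ (e.symm y)) =ᶠ[𝓝 (e x)] fun _ => 0 := by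
        have ht := e.continuousAt_symm (e.map_source hxe)
        rw [ContinuousAt, e.left_inv hxe] at ht
        exact ht.eventually (hout x hx)
      refine ⟨e, IsManifold.chart_mem_maximalAtlas x, hxe,
        contDiffAt_const.congr_of_eventuallyEq h0, ?_⟩
      have hp : ∀ i, pd i (fun _ => (0 : ℝ)) = fun _ => 0 := fun i => by
        funext z; exact pd_const i 0 z
      rw [laplacian_congr h0]
      simpa [laplacian, hp] using hBC
    push Not at hx
    obtain ⟨a, y, hy, rfl⟩ := hx
    obtain ⟨e, he, h1, h2, h3, h4⟩ := hchart a y hy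
    have hye : y ∈ e.target := h2 ▸ e.map_source h1
    have hm := comp_eventuallyEq g h3
    refine ⟨e, he, h1, ?_, ?_⟩ <;> rw [h2]
    · exact (hsm a).contDiffAt.congr_of_eventuallyEq h4
    · rw [laplacian_congr h4, laplacian_congr_metric hm]
      refine (hlap a y hy ((isMetricAt_comp g he hye).congr hm.symm) χ (ρ' a) C hχ hχC).trans ?_
      exact mul_le_mul_of_nonneg_right
        (Finset.single_le_sum (fun a _ => hB a) (Finset.mem_univ a)) hC

end Surface

end ACSurface

end

theorem mainTheorem7 {M : Type*} [TopologicalSpace M] [T2Space M]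
    [ChartedSpace ACSurface.Plane M] [IsManifold (𝓡 2) ∞ M]
    (τ : ℝ) (g : ℝ → ACSurface.Metric M)
    (hAC : ACSurface.IsAsymptoticallyConical τ (g 0))
    (hflow : ACSurface.IsRicciFlow g)
    (hbdd : ACSurface.HasBoundedCurvature g)
    (hR₀ : ∀ x : M, ACSurface.scalarCurvature (g 0) x ≤ 0) :
    ∀ t : ℝ, 0 ≤ t → ∀ x : M, ACSurface.scalarCurvature (g t) x ≤ 0 := by
  obtain ⟨φ, B, hφ⟩ := hAC.exists_isBarrier
  exact fun t ht x => hflow.scalarCurvature_nonpos hφ hbdd hR₀ t ht x
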